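/- Let $\triangle\subset\mathbb R^n$ be a reflexive lattice polytope, $\triangle^\vee=\{u:\langle x,u\rangle\ge -1\ \forall x\in\triangle\}$ its dual, and $X=\mathbb P_\triangle$ the corresponding Gorenstein Fano toric variety. Assume that $\triangle$ and $\triangle^\vee$ admit regular projective triangulations, and fix such triangulations $\mathcal T$ of $\triangle$ and $\mathcal T^\vee$ of $\triangle^\vee$: the vertices are lattice points, the origin is a vertex of every maximal simplex, all maximal simplices are unimodular, and there is a strictly convex function that is affine on each simplex. Let $\Sigma_{\triangle,\mathcal T}$ and $\Sigma_{\triangle^\vee,\mathcal T^\vee}$ be the fans of cones over the simplices of $\mathcal T$ and $\mathcal T^\vee$, and let $\widetilde{X^\vee}$ be the smooth projective toric variety of $\Sigma_{\triangle,\mathcal T}$. Let $\mathcal A=\triangle\cap\mathbb Z^n=\{v_0=0,v_1,\dots,v_p\}$ and $L=\{\ell\in\mathbb Z^{p+1}:\sum_i\ell_iv_i=0,\ \sum_i\ell_i=0\}$. Let $M$ be the set of $\ell\in L$ with $\sum_i\omega_i\ell_i\ge0$ for all weights $\omega\in\mathbb R^{p+1}$ for which the $\mathcal T$-piecewise linear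 function with values $\omega_i$ at $v_i$ is convex (the integral points of the Mori cone of $\widetilde{X^\vee}$). The cohomology ring $H^\bullet(\widetilde{X^\vee},\mathbb C)$ is the quotient of $\mathbb C[D_0,\dots,D_p]$ by the relations $\sum_{i=0}^pD_i=0$, $\sum_{i=1}^p v_i^jD_i=0$ $(1\le j\le n)$, and $D_{i_1}\cdots D_{i_k}=0$ whenever $\{i_1,\dots,i_k\}\subset\{1,\dots,p\}$ is a nonempty set such that $v_{i_1},\dots,v_{i_k}$ do not generate a cone of $\Sigma_{\triangle,\mathcal T}$. Put $$B_{X,\mathcal T}(a)=\frac1{a_0}\Big(\sum_{\ell\in M}O_\ell\,\prod_{i=0}^pa_i^{\ell_i}\Big)\exp\Big(\sum_{i=0}^p(\log a_i)D_i\Big),$$ $$O_\ell=\frac{\prod_{i\ge1,\,\ell_i<0}D_i(D_i-1)\cdots(D_i+\ell_i+1)}{\prod_{i\ge1,\,\ell_i\ge0}(D_i+1)\cdots(D_i+\ell_i)}\,(D_0-1)(D_0-2)\cdots(D_0+\ell_0).$$ Let $R(\Sigma_{\triangle^\vee,\mathcal T^\vee})$ be the set of $v\in\mathbb Z^n$ for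 which there is a primitive ray generator $u\in\Sigma_{\triangle^\vee,\mathcal T^\vee}(1)$ with $\langle v,u\rangle=-1$ and $\langle v,u'\rangle\ge0$ for all $u'\in\Sigma_{\triangle^\vee,\mathcal T^\vee}(1)$, $u'\ne u$. For such $v$, with corresponding $u$, put $$\pounds_v=\sum_{v'\in\mathcal A,\ \langle v',u\rangle\ne-1}(\langle v',u\rangle+1)\,a_{v'}\frac{\partial}{\partial a_{v'+v}}.$$ **Theorem.** There is $\varepsilon\in(0,1)$ such that the set $\{a\in(\mathbb C^*)^{p+1}:|a^\ell|<\varepsilon\text{ for all }0\ne\ell\in M\}$ (a neighbourhood of the large complex structure limit) is open and nonempty, the sum over $M$ in $B_{X,\mathcal T}(a)$ converges absolutely at each of its points, and the following holds on every open subset $U$ of it on which continuous branches of all $\log a_i$ are given. For every linear form $\alpha$ on $H^\bullet(\widetilde{X^\vee},\mathbb C)$ the coefficient function $f(a)=\langle B_{X,\mathcal T}(a)\cdot(-D_0),\alpha\rangle$ is analytic on $U$ and satisfies $$\pounds_v f=0\qquad\text{for all }v\in R(\Sigma_{\triangle^\vee,\mathcal T^\vee}),$$ that is, $\pounds_v\big(B_{X,\mathcal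 T}(a)\cdot(-D_0)\big)=0$. Moreover $f$ solves the extended GKZ-system on $U$: in addition to $\pounds_vf=0$ for all roots $v$, $$\Big(\prod_{\ell_i>0}\Big(\tfrac{\partial}{\partial a_i}\Big)^{\ell_i}-\prod_{\ell_j<0}\Big(\tfrac{\partial}{\partial a_j}\Big)^{-\ell_j}\Big)f=0\ (\ell\in L),\qquad \sum_{i=1}^pv_i^ja_i\frac{\partial f}{\partial a_i}=0\ (1\le j\le n),\qquad \Big(\sum_{i=0}^pa_i\frac{\partial}{\partial a_i}+1\Big)f=0.$$ -/

import Mathlib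

open Finset Set

noncomputable section

namespace ToricGKZ

/-! ### Reflexive polytopes and regular projective triangulations -/

/-- The inclusion of the lattice `ℤⁿ` into `ℝⁿ`. -/
def latt {n : ℕ} (v : Fin n → ℤ) : Fin n → ℝ := fun i => (v i : ℝ)

/-- `Q` is a lattice polytope: the convex hull of finitely many points of `ℤⁿ`. -/
def IsLatticePolytope {n : ℕ} (Q : Set (Fin n → ℝ)) : Prop :=
  ∃ V : Finset (Fin n → ℤ), Q = convexHull ℝ (latt '' (V : Set (Fin n → ℤ)))

/-- The dual (polar) `Q^∨ = {u | ⟨x, u⟩ ≥ -1 for all x ∈ Q}`. -/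
def polarDual {n : ℕ} (Q : Set (Fin n → ℝ)) : Set (Fin n → ℝ) :=
  {u | ∀ x ∈ Q, -1 ≤ x ⬝ᵥ u}

/-- A reflexive polytope in `ℝⁿ`: a lattice polytope with the origin in its interior whose dual is
again a lattice polytope. -/
structure ReflexivePolytope (n : ℕ) where
  carrier : Set (Fin n → ℝ)
  isLatticePolytope : IsLatticePolytope carrier
  zero_mem_interior : (0 : Fin n → ℝ) ∈ interior carrier
  dual_isLatticePolytope : IsLatticePolytope (polarDual carrier)

/-- A regular projective triangulation of `Q`: a triangulation with lattice points as vertices,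
such that the origin is a vertex of every maximal simplex, all maximal simplices are unimodular,
and there is a strictly convex piecewise linear function. -/
structure RegularProjectiveTriangulation {n : ℕ} (Q : Set (Fin n → ℝ)) where
  complex : Geometry.SimplicialComplex ℝ (Fin n → ℝ)
  space_eq : complex.space = Q
  vertices_integral : ∀ x ∈ complex.vertices, ∃ v : Fin n → ℤ, latt v = x
  zero_mem_facets : ∀ s ∈ complex.facets, (0 : Fin n → ℝ) ∈ s
  /-- As `0` is a vertex of the simplex `s`, its normalized volume is `1` exactly when its vertices
  generate the lattice `ℤⁿ`. -/
  unimodular : ∀ s ∈ complex.facets, ∀ v : Fin n → ℤ,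
    latt v ∈ Submodule.span ℤ (s : Set (Fin n → ℝ))
  /-- On each maximal simplex the heights `ω` agree with an affine function, which lies strictly
  below `ω` at all lattice points outside that simplex. -/
  projective : ∃ ω : (Fin n → ℤ) → ℝ, ∀ s ∈ complex.facets, ∃ (m : Fin n → ℝ) (c : ℝ),
    (∀ v, latt v ∈ s → m ⬝ᵥ latt v + c = ω v) ∧
    ∀ v, latt v ∈ Q → latt v ∉ s → m ⬝ᵥ latt v + c < ω v

/-- The rays (primitive generators) `Σ(1)` of the fan of cones over the simplices of a regular
projective triangulation: its nonzero vertices. -/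
def RegularProjectiveTriangulation.rays {n : ℕ} {Q : Set (Fin n → ℝ)}
    (T : RegularProjectiveTriangulation Q) : Set (Fin n → ℤ) :=
  {u | u ≠ 0 ∧ latt u ∈ T.complex.vertices}

/-- `v` belongs to the root system `R(Σ)` of the fan of `T`, with corresponding ray `u`. -/
def RegularProjectiveTriangulation.IsRootWithRay {n : ℕ} {Q : Set (Fin n → ℝ)}
    (T : RegularProjectiveTriangulation Q) (v u : Fin n → ℤ) : Prop :=
  u ∈ T.rays ∧ v ⬝ᵥ u = -1 ∧ ∀ u' ∈ T.rays, u' ≠ u → 0 ≤ v ⬝ᵥ u'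

/-! ### Lattice points, relations, Mori cone -/

/-- The set `𝒜 = △ ∩ ℤⁿ` of lattice points of `△`. -/
abbrev ReflexivePolytope.Point {n : ℕ} (P : ReflexivePolytope n) : Type :=
  {v : Fin n → ℤ // latt v ∈ P.carrier}

theorem ReflexivePolytope.finite_points {n : ℕ} (P : ReflexivePolytope n) :
    Set.Finite {v : Fin n → ℤ | latt v ∈ P.carrier} := by
  obtain ⟨V, hV⟩ := P.isLatticePolytope
  have hb : Bornology.IsBounded P.carrier := by
    rw [hV]
    exact ((V.finite_toSet.image latt).isCompact_convexHull (𝕜 := ℝ)).isBounded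
  obtain ⟨R, hR⟩ := hb.exists_norm_le
  refine (Set.finite_Icc (fun _ : Fin n => -⌈R⌉) (fun _ => ⌈R⌉)).subset ?_
  intro v hv
  have h : ∀ i, |(v i : ℝ)| ≤ (⌈R⌉ : ℝ) := fun i =>
    ((norm_le_pi_norm (latt v) i).trans (hR _ hv)).trans (Int.le_ceil R)
  constructor
  · intro i
    have := (abs_le.1 (h i)).1
    exact_mod_cast this
  · intro i
    have := (abs_le.1 (h i)).2
    exact_mod_cast this

instance {n : ℕ} (P : ReflexivePolytope n) : Fintype P.Point := P.finite_points.fintype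

instance {n : ℕ} (P : ReflexivePolytope n) : DecidableEq P.Point := Classical.decEq _

/-- The lattice point `v₀ = 0` of `△`. -/
def ReflexivePolytope.origin {n : ℕ} (P : ReflexivePolytope n) : P.Point :=
  ⟨0, by
    have h : latt (0 : Fin n → ℤ) = 0 := by ext; simp [latt]
    rw [h]
    exact interior_subset P.zero_mem_interior⟩

/-- The lattice `L` of affine relations among the lattice points of `△`. -/
def ReflexivePolytope.relations {n : ℕ} (P : ReflexivePolytope n) : Set (P.Point → ℤ) :=
  {ℓ | ∑ v, ℓ v • v.1 = 0 ∧ ∑ v, ℓ v = 0}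

variable {n : ℕ} {P : ReflexivePolytope n}

/-- The preimage in `ℝ^𝒜` of the (closed) Kähler cone: weights `ω` for which the `T`-piecewise
linear function with values `ω v` at the lattice points `v` is convex, i.e. on every maximal
simplex it extends to an affine function lying below `ω` everywhere. -/
def kaehlerCone (T : RegularProjectiveTriangulation P.carrier) : Set (P.Point → ℝ) :=
  {ω | ∀ s ∈ T.complex.facets, ∃ (m : Fin n → ℝ) (c : ℝ),
    (∀ v : P.Point, latt v.1 ∈ s → m ⬝ᵥ latt v.1 + c = ω v) ∧
    ∀ v : P.Point, m ⬝ᵥ latt v.1 + c ≤ ω v}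

/-- The set `M` of integral points of the Mori cone, the dual of the Kähler cone. -/
def moriPoints (T : RegularProjectiveTriangulation P.carrier) : Set (P.Point → ℤ) :=
  {ℓ | ℓ ∈ P.relations ∧ ∀ ω ∈ kaehlerCone T, 0 ≤ ∑ v, ω v * (ℓ v : ℝ)}

/-! ### The cohomology ring -/

/-- The ideal generated by the linear equivalence relations and by the Stanley–Reisner ideal.
A nonempty set of nonzero lattice points of `△` generates a cone of the fan exactly when it is a
simplex of `T`. -/
def cohomologyIdeal (T : RegularProjectiveTriangulation P.carrier) :
    Ideal (MvPolynomial P.Point ℂ) :=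
  Ideal.span
    ({∑ v : P.Point, MvPolynomial.X v} ∪
      {q | ∃ j : Fin n, q = ∑ v : P.Point, MvPolynomial.C ((v.1 j : ℤ) : ℂ) * MvPolynomial.X v} ∪
      {q | ∃ S : Finset P.Point, S.Nonempty ∧ P.origin ∉ S ∧
        (∀ s ∈ T.complex.faces,
          (s : Set (Fin n → ℝ)) ≠ (fun v : P.Point => latt v.1) '' (S : Set P.Point)) ∧
        q = ∏ v ∈ S, MvPolynomial.X v})

/-- The cohomology ring `H^•(X̃^∨_T, ℂ)` of the smooth projective toric variety of the fan of
cones over the simplices of `T`, in its standard presentation. -/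
def CohomologyRing (T : RegularProjectiveTriangulation P.carrier) : Type :=
  MvPolynomial P.Point ℂ ⧸ cohomologyIdeal T

instance (T : RegularProjectiveTriangulation P.carrier) : CommRing (CohomologyRing T) :=
  inferInstanceAs (CommRing (MvPolynomial P.Point ℂ ⧸ cohomologyIdeal T))

instance (T : RegularProjectiveTriangulation P.carrier) : Algebra ℂ (CohomologyRing T) :=
  inferInstanceAs (Algebra ℂ (MvPolynomial P.Point ℂ ⧸ cohomologyIdeal T))

instance (T : RegularProjectiveTriangulation P.carrier) : Algebra ℚ (CohomologyRing T) :=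
  Algebra.compHom (CohomologyRing T) (algebraMap ℚ ℂ)

/-- The ring is a finite-dimensional complex vector space; it carries the usual topology of such a
space. -/
instance (T : RegularProjectiveTriangulation P.carrier) : TopologicalSpace (CohomologyRing T) :=
  moduleTopology ℂ (CohomologyRing T)

/-- The divisor class `D_v`, `v ∈ 𝒜` (so `D₀` is the canonical class). -/
def divisor (T : RegularProjectiveTriangulation P.carrier) (v : P.Point) : CohomologyRing T :=
  Ideal.Quotient.mk (cohomologyIdeal T) (MvPolynomial.X v)

/-! ### The series `B` -/

/-- The coefficient `O_ℓ`. The products over `range (-ℓ v).toNat` and `range (ℓ v).toNat` are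
empty unless `ℓ v < 0`, respectively `ℓ v > 0`. The divisor classes are nilpotent, so the
denominator is a unit of the ring. -/
def coeffO (T : RegularProjectiveTriangulation P.carrier) (ℓ : P.Point → ℤ) : CohomologyRing T :=
  (∏ v ∈ univ.erase P.origin, ∏ k ∈ range (-ℓ v).toNat, (divisor T v - (k : CohomologyRing T))) *
  Ring.inverse (∏ v ∈ univ.erase P.origin,
    ∏ k ∈ range (ℓ v).toNat, (divisor T v + ((k + 1 : ℕ) : CohomologyRing T))) *
  ∏ k ∈ range (-ℓ P.origin).toNat, (divisor T P.origin - ((k + 1 : ℕ) : CohomologyRing T))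

/-- The monomial `a^ℓ = ∏ a_v^{ℓ_v}`. -/
def monomial (a : P.Point → ℂ) (ℓ : P.Point → ℤ) : ℂ := ∏ v, a v ^ ℓ v

/-- The series `B_{X,T}(a)`, where `lg a v` is the value of `log a_v` for the chosen branches of
the logarithms. -/
def seriesB (T : RegularProjectiveTriangulation P.carrier)
    (lg : (P.Point → ℂ) → (P.Point → ℂ)) (a : P.Point → ℂ) : CohomologyRing T :=
  (a P.origin)⁻¹ • ((∑' ℓ : moriPoints T, monomial a ℓ.1 • coeffO T ℓ.1) *
    IsNilpotent.exp (∑ v, lg a v • divisor T v))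

/-- A neighbourhood of the large complex structure limit in the torus `(ℂ^*)^𝒜`: all monomials
`a^ℓ` with `0 ≠ ℓ ∈ M` are smaller than `ε`. -/
def nearLCSL (T : RegularProjectiveTriangulation P.carrier) (ε : ℝ) : Set (P.Point → ℂ) :=
  {a | (∀ v, a v ≠ 0) ∧ ∀ ℓ ∈ moriPoints T, ℓ ≠ 0 → ‖monomial a ℓ‖ < ε}

/-! ### The extended GKZ-system -/

/-- The partial derivative `∂/∂a_v`. -/
def partialD (v : P.Point) (f : (P.Point → ℂ) → ℂ) : (P.Point → ℂ) → ℂ :=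
  fun a => lineDeriv ℂ f a (Pi.single v 1)

/-- The higher partial derivative `∏_v (∂/∂a_v)^{m_v}`. (The order in which the derivatives are
taken plays no role for analytic functions.) -/
def mixedD (m : P.Point → ℕ) (f : (P.Point → ℂ) → ℂ) : (P.Point → ℂ) → ℂ :=
  (univ : Finset P.Point).toList.foldr (fun v g => (partialD v)^[m v] g) f

/-- The analytic function `f` solves the GKZ-system on `U`. -/
structure IsGKZSolution (U : Set (P.Point → ℂ)) (f : (P.Point → ℂ) → ℂ) : Prop where
  analytic : AnalyticOnNhd ℂ f U
  box : ∀ ℓ ∈ P.relations, ∀ a ∈ U,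
    mixedD (fun v => (ℓ v).toNat) f a - mixedD (fun v => (-ℓ v).toNat) f a = 0
  torus : ∀ j : Fin n, ∀ a ∈ U, ∑ v : P.Point, ((v.1 j : ℤ) : ℂ) * a v * partialD v f a = 0
  euler : ∀ a ∈ U, ∑ v, a v * partialD v f a + f a = 0

/-- The indices occurring in the root operator are well defined: `v' + v` lies in `△`. -/
theorem add_mem_of_isRootWithRay {T' : RegularProjectiveTriangulation (polarDual P.carrier)}
    {v u : Fin n → ℤ} (h : T'.IsRootWithRay v u) (v' : P.Point) (hv' : v'.1 ⬝ᵥ u ≠ -1) :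
    latt (v'.1 + v) ∈ P.carrier := by
  have hdot : ∀ x y : Fin n → ℤ, latt x ⬝ᵥ latt y = ((x ⬝ᵥ y : ℤ) : ℝ) := by
    intro x y
    simp [latt, dotProduct]
  have key : ∀ y ∈ polarDual P.carrier, -1 ≤ latt (v'.1 + v) ⬝ᵥ y := by
    intro y hy
    have hy' := hy
    rw [← T'.space_eq, Geometry.SimplicialComplex.mem_space_iff] at hy'
    obtain ⟨s, hs, hys⟩ := hy'
    have hconv : Convex ℝ {y : Fin n → ℝ | -1 ≤ latt (v'.1 + v) ⬝ᵥ y} := by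
      intro a ha b hb p q hp hq hpq
      simp only [Set.mem_ofPred_eq, dotProduct_add, dotProduct_smul, smul_eq_mul] at *
      nlinarith
    refine convexHull_min ?_ hconv hys
    intro z hz
    have hzP : z ∈ polarDual P.carrier := by
      rw [← T'.space_eq]
      exact T'.complex.subset_space hs hz
    have hzv : z ∈ T'.complex.vertices :=
      T'.complex.down_closed hs (by simpa using hz) (by simp)
    obtain ⟨w, rfl⟩ := T'.vertices_integral z hzv
    have h1 : -1 ≤ v'.1 ⬝ᵥ w := by
      have := hzP _ v'.2
      rw [hdot] at this
      exact_mod_cast this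
    simp only [Set.mem_ofPred_eq]
    rw [hdot]
    have h2 : -1 ≤ (v'.1 + v) ⬝ᵥ w := by
      rw [add_dotProduct]
      by_cases hw0 : w = 0
      · subst hw0
        simp
      by_cases hwu : w = u
      · subst hwu
        have := h.2.1
        omega
      · have := h.2.2 w ⟨hw0, hzv⟩ hwu
        omega
    exact_mod_cast h2
  obtain ⟨V, hV⟩ := P.isLatticePolytope
  have hc : Convex ℝ P.carrier := by
    rw [hV]
    exact convex_convexHull ℝ _
  have hcl : IsClosed P.carrier := by
    rw [hV]
    exact ((V.finite_toSet.image latt).isCompact_convexHull (𝕜 := ℝ)).isClosed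
  by_contra hx
  obtain ⟨f, r, hfx, hfP⟩ := geometric_hahn_banach_point_closed hc hcl hx
  have hr : r < 0 := by
    have := hfP 0 (interior_subset P.zero_mem_interior)
    simpa using this
  have hf : ∀ x : Fin n → ℝ, f x = x ⬝ᵥ (fun i => f (Pi.single i 1)) := by
    intro x
    conv_lhs => rw [pi_eq_sum_univ' x]
    simp [dotProduct, map_sum]
  have hy := key ((-r)⁻¹ • (fun i => f (Pi.single i 1))) (by
    intro x hxP
    have := hfP x hxP
    rw [dotProduct_smul, ← hf, smul_eq_mul, ← div_eq_inv_mul, le_div_iff₀ (by linarith)]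
    linarith)
  rw [dotProduct_smul, ← hf, smul_eq_mul, ← div_eq_inv_mul, le_div_iff₀ (by linarith)] at hy
  linarith

open Classical in
/-- The operator `£_v`, for a root `v` with corresponding ray `u`: the sum of
`(⟨v', u⟩ + 1) a_{v'} ∂/∂a_{v' + v}` over the lattice points `v'` of `△` not on the facet
`⟨v', u⟩ = -1`. For these `v'` there is exactly one lattice point `w` of `△` with `w = v' + v`,
see `add_mem_of_isRootWithRay`. -/
def rootOperator (v u : Fin n → ℤ) (f : (P.Point → ℂ) → ℂ) : (P.Point → ℂ) → ℂ :=
  fun a => ∑ v' : P.Point, ∑ w : P.Point,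
    if v'.1 ⬝ᵥ u ≠ -1 ∧ w.1 = v'.1 + v then
      ((v'.1 ⬝ᵥ u + 1 : ℤ) : ℂ) * a v' * partialD w f a
    else 0

/-- `f` solves the extended GKZ-system on `U`; the roots are those of the fan over `T'`, a
triangulation of the dual polytope. -/
structure IsExtendedGKZSolution (T' : RegularProjectiveTriangulation (polarDual P.carrier))
    (U : Set (P.Point → ℂ)) (f : (P.Point → ℂ) → ℂ) : Prop extends IsGKZSolution U f where
  root : ∀ v u, T'.IsRootWithRay v u → ∀ a ∈ U, rootOperator v u f a = 0

end ToricGKZ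

end

/-! Give an exponent `p` the degree `(∑ p_v v, ∑ p_v)` in `ℤⁿ × ℤ`. For each degree `d` let `F_d` be
the sum over all exponents of degree `d` of `a^p ∏_v Γ(D_v+1)/Γ(D_v+p_v+1)`, multiplied by `exp(∑
log a_v D_v)`. Because `Γ(x+1) = xΓ(x)`, differentiation only moves the degree: `∂_v F_d =
F_{d-(v,1)}` (`lineDeriv_gammaSeries`). Since `a_v ∂_v` multiplies the `p`-th term by `D_v + p_v`,
integral weights `c` with `∑ c_v D_v = 0` give `∑ c_v a_v ∂_v F_d = (∑ c_v p_v) F_d` whenever the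
last sum depends only on `d` (`sum_mul_lineDeriv_gammaSeries`). The linear relations of the
cohomology ring supply the weights `⟨v,u⟩ + k`.

The function of the theorem is a linear form applied to `-F_{(0,-1)}` (`map_seriesB_mul`). The box
equations hold because both derivatives have the same degree, and the torus and Euler equations are
cases of the weight identity. For a root `v` with ray `u`, `∂_{v'+v} F_{(0,-1)} = F_{(-v-v',-2)} =
∂_{v'} F_{(-v,-1)}`. Hence `£_v` acts as `∑ (⟨v',u⟩+1) a_{v'} ∂_{v'}` on `F_{(-v,-1)}`, with
eigenvalue `-⟨v,u⟩ - 1 = 0`; the points omitted from `£_v` have weight zero.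

Two facts identify the series. A nonzero coefficient has its negative nonzero indices in one simplex
by the Stanley–Reisner relations, so the exponent lies in a translate of the Mori cone
(`add_mem_moriPoints_of_gammaCoeff_ne_zero`). On `M` one has `ℓ_0 ≤ 0`, by convexity of the polytope
(`dotProduct_le_one`, `moriPoints_origin_nonpos`), so that `O_ℓ D_0` is the coefficient at `ℓ -
e_0`.

For convergence, `M` is finitely generated (`exists_mori_generators`) and the coefficients grow at
most exponentially, at a rate independent of the degree (`norm_gammaCoeff_le`). Each series is
therefore a Laurent monomial times a convergent power series in the monomials of the generators, and
one `ε` serves all derivatives. -/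

noncomputable section

namespace ToricGKZ

/-! ### Gamma factors of nilpotent elements -/

section GammaFactor

variable {R : Type*} [CommRing R]

/-- The formal quotient `Γ(x + 1) / Γ(x + k + 1)`, which makes sense when `x` is nilpotent. -/
def gammaFactor (x : R) (k : ℤ) : R :=
  (∏ j ∈ Finset.range (-k).toNat, (x - (j : R))) *
    Ring.inverse (∏ j ∈ Finset.range k.toNat, (x + ((j + 1 : ℕ) : R)))

theorem isUnit_nilpotent_add_natCast [Algebra ℂ R] {x : R} (hx : IsNilpotent x) (j : ℕ) :
    IsUnit (x + ((j + 1 : ℕ) : R)) := by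
  have h : IsUnit (((j + 1 : ℕ) : R)) := by
    have h1 : IsUnit (((j + 1 : ℕ) : ℂ)) := (Nat.cast_ne_zero.2 (Nat.succ_ne_zero j)).isUnit
    simpa using h1.map (algebraMap ℂ R)
  rw [add_comm]
  exact hx.isUnit_add_left_of_commute h (Commute.all _ _)

/-- The functional equation of Γ. For `k ≤ 0` the factor `x + k` extends the numerator by one term;
for `k > 0` it cancels the last factor of the denominator, a unit since `x` is nilpotent. -/
theorem add_mul_gammaFactor [Algebra ℂ R] {x : R} (hx : IsNilpotent x) (k : ℤ) :
    (x + (k : R)) * gammaFactor x k = gammaFactor x (k - 1) := by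
  rcases le_or_gt k 0 with hk | hk
  · obtain ⟨m, rfl⟩ : ∃ m : ℕ, k = -(m : ℤ) := ⟨(-k).toNat, by omega⟩
    have h1 : (-(-(m : ℤ))).toNat = m := by omega
    have h2 : (-(-(m : ℤ) - 1)).toNat = m + 1 := by omega
    have h3 : (-(m : ℤ)).toNat = 0 := by omega
    have h4 : (-(m : ℤ) - 1).toNat = 0 := by omega
    rw [gammaFactor, gammaFactor, h1, h2, h3, h4, Finset.prod_range_succ]
    push_cast
    ring
  · obtain ⟨m, rfl⟩ : ∃ m : ℕ, k = (m : ℤ) + 1 := ⟨(k - 1).toNat, by omega⟩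
    have h1 : (-((m : ℤ) + 1)).toNat = 0 := by omega
    have h2 : (-((m : ℤ) + 1 - 1)).toNat = 0 := by omega
    have h3 : ((m : ℤ) + 1).toNat = m + 1 := by omega
    have h4 : ((m : ℤ) + 1 - 1).toNat = m := by omega
    rw [gammaFactor, gammaFactor, h1, h2, h3, h4, Finset.prod_range_succ,
      Ring.mul_inverse_rev]
    have h5 := Ring.mul_inverse_cancel _ (isUnit_nilpotent_add_natCast hx m)
    push_cast at h5 ⊢
    simp only [Finset.range_zero, Finset.prod_empty, one_mul]
    rw [← mul_assoc, h5, one_mul]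

theorem map_ringInverse_equiv {S : Type*} [CommRing S] (φ : R ≃+* S) (x : R) :
    φ (Ring.inverse x) = Ring.inverse (φ x) := by
  by_cases hx : IsUnit x
  · have h := congrArg φ (Ring.mul_inverse_cancel x hx)
    rw [map_mul, map_one] at h
    have h' := Ring.inverse_mul_cancel (φ x) (hx.map φ)
    calc φ (Ring.inverse x) = (Ring.inverse (φ x) * φ x) * φ (Ring.inverse x) := by
          rw [h', one_mul]
      _ = Ring.inverse (φ x) := by rw [mul_assoc, h, mul_one]
  · have hx' : ¬ IsUnit (φ x) := by simpa using hx
    rw [Ring.inverse_non_unit _ hx, Ring.inverse_non_unit _ hx', map_zero]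

theorem map_gammaFactor {S : Type*} [CommRing S] (φ : R ≃+* S) (x : R) (k : ℤ) :
    φ (gammaFactor x k) = gammaFactor (φ x) k := by
  simp [gammaFactor, map_ringInverse_equiv]

variable {ι : Type*} [Fintype ι]

/-- The product of the gamma factors of `D i` at `p i`. -/
def gammaCoeff (D : ι → R) (p : ι → ℤ) : R := ∏ i, gammaFactor (D i) (p i)

theorem add_mul_gammaCoeff [DecidableEq ι] [Algebra ℂ R] {D : ι → R} (hD : ∀ i, IsNilpotent (D i)) (p : ι → ℤ)
    (i : ι) : (D i + (p i : R)) * gammaCoeff D p = gammaCoeff D (p - Pi.single i 1) := by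
  obtain ⟨q, hq⟩ : ∃ q, q = p - Pi.single i 1 := ⟨_, rfl⟩
  rw [← hq, gammaCoeff, gammaCoeff,
    ← Finset.mul_prod_erase _ (fun j => gammaFactor (D j) (p j)) (Finset.mem_univ i),
    ← Finset.mul_prod_erase _ (fun j => gammaFactor (D j) (q j)) (Finset.mem_univ i),
    ← mul_assoc, add_mul_gammaFactor (hD i), hq]
  congr 1
  · simp
  · refine Finset.prod_congr rfl fun j hj => ?_
    simp [Finset.ne_of_mem_erase hj]

theorem map_gammaCoeff {S : Type*} [CommRing S] (φ : R ≃+* S) (D : ι → R) (p : ι → ℤ) :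
    φ (gammaCoeff D p) = gammaCoeff (fun i => φ (D i)) p := by
  simp [gammaCoeff, map_gammaFactor]

end GammaFactor

/-! ### Exponential growth of the gamma coefficients. -/

section GammaBound

variable {A : Type*} [NormedCommRing A]

/-- With `c = j + 1`, write `x + c = c(1 + x/c)`. The geometric series in `-x/c` stops by
nilpotency, and `|1/c| ≤ 1` bounds it independently of `j`. -/
theorem norm_inverse_nilpotent_add_le [NormedAlgebra ℂ A] {x : A} (hx : IsNilpotent x) :
    ∃ C : ℝ, ∀ j : ℕ, ‖Ring.inverse (x + ((j + 1 : ℕ) : A))‖ ≤ C / (j + 1 : ℕ) := by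
  obtain ⟨N, hN⟩ := hx
  refine ⟨∑ i ∈ Finset.range N, ‖x ^ i‖, fun j => ?_⟩
  set c : ℂ := ((j + 1 : ℕ) : ℂ) with hc
  have hc0 : c ≠ 0 := Nat.cast_ne_zero.2 (Nat.succ_ne_zero j)
  have hcn : ‖c⁻¹‖ = ((j + 1 : ℕ) : ℝ)⁻¹ := by rw [norm_inv, hc, Complex.norm_natCast]
  have hc1 : ‖c⁻¹‖ ≤ 1 := by
    rw [hcn]
    exact inv_le_one_of_one_le₀ (by exact_mod_cast Nat.succ_le_succ (Nat.zero_le j))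
  set y : A := (-c⁻¹) • x with hy
  have hyN : y ^ N = 0 := by rw [hy, smul_pow, hN, smul_zero]
  have hgeom := mul_neg_geom_sum y N
  have hxc : x + ((j + 1 : ℕ) : A) = c • (1 - y) := by
    rw [hy, smul_sub, smul_smul, mul_neg, mul_inv_cancel₀ hc0, neg_one_smul, sub_neg_eq_add,
      add_comm, ← Algebra.algebraMap_eq_smul_one, hc, map_natCast]
  have hinv : (x + ((j + 1 : ℕ) : A)) * (c⁻¹ • ∑ i ∈ Finset.range N, y ^ i) = 1 := by
    rw [hxc, smul_mul_smul_comm, mul_inv_cancel₀ hc0, one_smul, hgeom, hyN, sub_zero]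
  have hu : IsUnit (x + ((j + 1 : ℕ) : A)) := IsUnit.of_mul_eq_one _ hinv
  have heq : Ring.inverse (x + ((j + 1 : ℕ) : A)) = c⁻¹ • ∑ i ∈ Finset.range N, y ^ i := by
    calc _ = Ring.inverse (x + ((j + 1 : ℕ) : A)) *
          ((x + ((j + 1 : ℕ) : A)) * (c⁻¹ • ∑ i ∈ Finset.range N, y ^ i)) := by
            rw [hinv, mul_one]
      _ = _ := by rw [← mul_assoc, Ring.inverse_mul_cancel _ hu, one_mul]
  rw [heq, norm_smul, hcn, div_eq_inv_mul]
  refine mul_le_mul_of_nonneg_left ((norm_sum_le _ _).trans ?_) (by positivity)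
  refine Finset.sum_le_sum fun i _ => ?_
  rw [hy, smul_pow, norm_smul, norm_pow, norm_neg]
  exact mul_le_of_le_one_left (norm_nonneg _) (pow_le_one₀ (norm_nonneg _) hc1)

/-- Meant for `D_0 - 1`, which takes the place of `D_0` in `O_ℓ` and is not covered by the nilpotent
case. The index shift costs a factor `2`; the new index `0` only contributes the constant
`‖Ring.inverse x‖`, whether or not `x` is a unit. -/
theorem norm_inverse_sub_one_add_le {x : A}
    (hx : ∃ C : ℝ, ∀ j : ℕ, ‖Ring.inverse (x + ((j + 1 : ℕ) : A))‖ ≤ C / (j + 1 : ℕ)) :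
    ∃ C : ℝ, ∀ j : ℕ, ‖Ring.inverse (x - 1 + ((j + 1 : ℕ) : A))‖ ≤ C / (j + 1 : ℕ) := by
  obtain ⟨C, hC⟩ := hx
  have hC0 : 0 ≤ C := by simpa using (norm_nonneg _).trans (hC 0)
  refine ⟨max ‖Ring.inverse x‖ (2 * C), fun j => ?_⟩
  have h1 : x - 1 + ((j + 1 : ℕ) : A) = x + (j : A) := by
    push_cast
    ring
  rw [h1]
  cases j with
  | zero => simp
  | succ j =>
    refine (hC j).trans ?_
    rw [div_le_div_iff₀ (by positivity) (by positivity)]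
    have h2 : 2 * C ≤ max ‖Ring.inverse x‖ (2 * C) := le_max_right _ _
    have h3 : (0 : ℝ) ≤ j := Nat.cast_nonneg j
    push_cast
    calc C * (j + 1 + 1) ≤ 2 * C * (j + 1) := by nlinarith
      _ ≤ _ := by gcongr

theorem norm_gammaFactor_le {x : A}
    (hx : ∃ C : ℝ, ∀ j : ℕ, ‖Ring.inverse (x + ((j + 1 : ℕ) : A))‖ ≤ C / (j + 1 : ℕ)) :
    ∃ K C : ℝ, 1 ≤ K ∧ 1 ≤ C ∧ ∀ k : ℤ, ‖gammaFactor x k‖ ≤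
      K * C ^ k.natAbs * ((-k).toNat.factorial / k.toNat.factorial) := by
  obtain ⟨C₁, hC₁⟩ := hx
  -- `C₁` pays for a denominator factor and `‖x‖ + ‖1‖` for a numerator factor; `‖1‖ = 1` is not
  -- assumed.
  set C : ℝ := max 1 (max C₁ (‖x‖ + ‖(1 : A)‖)) with hC
  have h1C : 1 ≤ C := le_max_left _ _
  have hnum : ∀ m : ℕ, ‖∏ j ∈ Finset.range m, (x - (j : A))‖ ≤
      ‖(1 : A)‖ * C ^ m * m.factorial := by
    intro m
    induction m with
    | zero => simp
    | succ m ih =>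
      rw [Finset.prod_range_succ]
      have h2 : ‖x - (m : A)‖ ≤ C * (m + 1) := by
        have h3 : ‖(m : A)‖ ≤ m * ‖(1 : A)‖ := by
          simpa using norm_nsmul_le (n := m) (a := (1 : A))
        have h4 : ‖x‖ + ‖(1 : A)‖ ≤ C := (le_max_right _ _).trans (le_max_right _ _)
        have h5 : (0 : ℝ) ≤ m := Nat.cast_nonneg m
        calc ‖x - (m : A)‖ ≤ ‖x‖ + ‖(m : A)‖ := norm_sub_le _ _
          _ ≤ ‖x‖ + m * ‖(1 : A)‖ := by linarith
          _ ≤ (‖x‖ + ‖(1 : A)‖) * (m + 1) := by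
              nlinarith [norm_nonneg x, norm_nonneg (1 : A), mul_nonneg h5 (norm_nonneg x)]
          _ ≤ C * (m + 1) := by gcongr
      calc _ ≤ ‖∏ j ∈ Finset.range m, (x - (j : A))‖ * ‖x - (m : A)‖ := norm_mul_le _ _
        _ ≤ (‖(1 : A)‖ * C ^ m * m.factorial) * (C * (m + 1)) := by gcongr
        _ = _ := by rw [Nat.factorial_succ]; push_cast; ring
  have hden : ∀ m : ℕ, ‖Ring.inverse (∏ j ∈ Finset.range m, (x + ((j + 1 : ℕ) : A)))‖ ≤
      ‖(1 : A)‖ * C ^ m / m.factorial := by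
    intro m
    induction m with
    | zero => simp
    | succ m ih =>
      rw [Finset.prod_range_succ, Ring.mul_inverse_rev]
      have h2 : ‖Ring.inverse (x + ((m + 1 : ℕ) : A))‖ ≤ C / (m + 1 : ℕ) :=
        (hC₁ m).trans (by gcongr; exact (le_max_left _ _).trans (le_max_right _ _))
      calc _ ≤ _ := norm_mul_le _ _
        _ ≤ (C / (m + 1 : ℕ)) * (‖(1 : A)‖ * C ^ m / m.factorial) := by gcongr
        _ = _ := by
          rw [Nat.factorial_succ]; push_cast; field_simp; ring
  refine ⟨max 1 (‖(1 : A)‖ * ‖(1 : A)‖), C, le_max_left _ _, h1C, fun k => ?_⟩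
  calc ‖gammaFactor x k‖ ≤ _ := norm_mul_le _ _
    _ ≤ (‖(1 : A)‖ * C ^ (-k).toNat * (-k).toNat.factorial) *
        (‖(1 : A)‖ * C ^ k.toNat / k.toNat.factorial) := by
          gcongr
          · exact hnum _
          · exact hden _
    _ = (‖(1 : A)‖ * ‖(1 : A)‖) * C ^ ((-k).toNat + k.toNat) *
        ((-k).toNat.factorial / k.toNat.factorial) := by rw [pow_add]; ring
    _ ≤ _ := by
        have : (-k).toNat + k.toNat = k.natAbs := by omega
        rw [this]
        gcongr
        exact le_max_right _ _

/-- The multinomial coefficient is one term in the expansion of `(1 + ⋯ + 1)^(∑ q)`. -/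
theorem factorial_le_pow_mul_prod_factorial {ι : Type*} [Fintype ι] [DecidableEq ι] (q : ι → ℕ) :
    (∑ i, q i).factorial ≤ Fintype.card ι ^ (∑ i, q i) * ∏ i, (q i).factorial := by
  rw [← Nat.multinomial_spec, mul_comm]
  refine Nat.mul_le_mul_right _ ?_
  have h := Finset.sum_pow_eq_sum_piAntidiag (R := ℕ) Finset.univ (fun _ : ι => 1) (∑ i, q i)
  simp only [Finset.sum_const, Finset.card_univ, smul_eq_mul, mul_one, one_pow,
    Finset.prod_const_one] at h
  rw [h]
  exact Finset.single_le_sum (f := fun k => Nat.multinomial Finset.univ k)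
    (fun _ _ => Nat.zero_le _) (by simp [Finset.mem_piAntidiag])

/-- The negative parts sum to `N` and the positive parts to `N'`, with `N ≤ N' + t`. So `N!` exceeds
`N'!` at most by `t!` and a binomial coefficient, and `N'!` is compared with the denominator by the
multinomial bound. For a fixed total only exponential growth remains. -/
theorem prod_factorial_div_le {ι : Type*} [Fintype ι] [DecidableEq ι] (p : ι → ℤ) :
    ∏ i, ((-p i).toNat.factorial / (p i).toNat.factorial : ℝ) ≤
      (∑ i, p i).natAbs.factorial * (2 * (Fintype.card ι + 1)) ^ (∑ i, (p i).natAbs) := by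
  set N := ∑ i, (-p i).toNat with hN
  set N' := ∑ i, (p i).toNat with hN'
  set t := (∑ i, p i).natAbs with ht
  have hsum : (∑ i, p i) = (N' : ℤ) - N := by
    rw [hN, hN']
    push_cast
    rw [← Finset.sum_sub_distrib]
    refine Finset.sum_congr rfl fun i _ => ?_
    rw [← Int.toNat_sub_toNat_neg (p i)]
    simp
  have habs : ∑ i, (p i).natAbs = N + N' := by
    rw [hN, hN', ← Finset.sum_add_distrib]
    refine Finset.sum_congr rfl fun i _ => ?_
    omega
  have h1 : ∏ i, (-p i).toNat.factorial ≤ N.factorial :=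
    Nat.le_of_dvd (Nat.factorial_pos _) (Nat.prod_factorial_dvd_factorial_sum _ _)
  have h2 := factorial_le_pow_mul_prod_factorial (fun i => (p i).toNat)
  have hNt : N ≤ N' + t := by omega
  have h3 : N.factorial ≤ (2 ^ (N + N') * t.factorial) * N'.factorial := by
    rcases le_or_gt N N' with h | h
    · calc N.factorial ≤ N'.factorial := Nat.factorial_le h
        _ ≤ _ := Nat.le_mul_of_pos_left _ (by positivity)
    · have hNe : N = N' + t := by omega
      have h4 := Nat.add_choose_mul_factorial_mul_factorial N' t
      rw [← hNe] at h4
      rw [← h4]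
      have h5 : N.choose t ≤ 2 ^ (N + N') :=
        (Nat.choose_le_two_pow _ _).trans (Nat.pow_le_pow_right (by norm_num) (by omega))
      calc _ = N.choose t * (t.factorial * N'.factorial) := by ring
        _ ≤ 2 ^ (N + N') * (t.factorial * N'.factorial) := Nat.mul_le_mul_right _ h5
        _ = _ := by ring
  rw [Finset.prod_div_distrib, div_le_iff₀ (by positivity), habs, mul_pow]
  have h6 : (Fintype.card ι) ^ N' ≤ (Fintype.card ι + 1) ^ (N + N') :=
    (Nat.pow_le_pow_left (Nat.le_succ _) _).trans
      (Nat.pow_le_pow_right (Nat.succ_pos _) (Nat.le_add_left _ _))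
  have h7 : ∏ i, (-p i).toNat.factorial ≤
      t.factorial * (2 ^ (N + N') * (Fintype.card ι + 1) ^ (N + N')) *
        ∏ i, (p i).toNat.factorial := by
    calc _ ≤ N.factorial := h1
      _ ≤ (2 ^ (N + N') * t.factorial) * N'.factorial := h3
      _ ≤ (2 ^ (N + N') * t.factorial) *
          ((Fintype.card ι + 1) ^ (N + N') * ∏ i, (p i).toNat.factorial) := by
            refine Nat.mul_le_mul_left _ (h2.trans ?_)
            exact Nat.mul_le_mul_right _ h6
      _ = _ := by ring
  exact_mod_cast h7

/-- The order of quantifiers matters: the rate `C` precedes the total `t`, and only `K` depends on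
`t`. Derivatives change `t`, so they keep the region of convergence. -/
theorem norm_gammaCoeff_le {ι : Type*} [Fintype ι] [DecidableEq ι] {D : ι → A}
    (hD : ∀ i, ∃ C : ℝ, ∀ j : ℕ,
      ‖Ring.inverse (D i + ((j + 1 : ℕ) : A))‖ ≤ C / (j + 1 : ℕ)) :
    ∃ C : ℝ, 1 ≤ C ∧ ∀ t : ℤ, ∃ K : ℝ, 0 ≤ K ∧ ∀ p : ι → ℤ, ∑ i, p i = t →
      ‖gammaCoeff D p‖ ≤ K * C ^ (∑ i, (p i).natAbs) := by
  choose K C hK hC h using fun i => norm_gammaFactor_le (hD i)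
  set C' : ℝ := ∏ i, C i with hC'
  have h1C' : 1 ≤ C' := Finset.one_le_prod fun i _ => hC i
  have hle : ∀ i, C i ≤ C' := fun i => by
    rw [hC', ← Finset.mul_prod_erase _ _ (Finset.mem_univ i)]
    exact le_mul_of_one_le_right (zero_le_one.trans (hC i))
      (Finset.one_le_prod fun j _ => hC j)
  have hKpos : 0 ≤ ∏ i, K i := Finset.prod_nonneg fun i _ => zero_le_one.trans (hK i)
  refine ⟨C' * (2 * (Fintype.card ι + 1)), ?_, fun t =>
    ⟨‖(1 : A)‖ * (∏ i, K i) * t.natAbs.factorial, by positivity, fun p hp => ?_⟩⟩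
  · exact one_le_mul_of_one_le_of_one_le h1C' (by
      have : (0 : ℝ) ≤ Fintype.card ι := Nat.cast_nonneg _
      linarith)
  have hprod : ∀ s : Finset ι, ‖∏ i ∈ s, gammaFactor (D i) (p i)‖ ≤
      ‖(1 : A)‖ * ∏ i ∈ s, (K i * C' ^ (p i).natAbs *
        ((-p i).toNat.factorial / (p i).toNat.factorial)) := by
    intro s
    induction s using Finset.induction_on with
    | empty => simp
    | insert i s hi ih =>
      rw [Finset.prod_insert hi, Finset.prod_insert hi]
      have h1 : ‖gammaFactor (D i) (p i)‖ ≤ K i * C' ^ (p i).natAbs *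
        ((-p i).toNat.factorial / (p i).toNat.factorial) := by
        refine (h i (p i)).trans ?_
        have := hle i
        have h0 := hK i
        have h00 := hC i
        gcongr
      calc _ ≤ _ := norm_mul_le _ _
        _ ≤ _ := mul_le_mul h1 ih (norm_nonneg _) ((norm_nonneg _).trans h1)
        _ = _ := by ring
  refine (hprod Finset.univ).trans ?_
  rw [Finset.prod_mul_distrib, Finset.prod_mul_distrib, Finset.prod_pow_eq_pow_sum, mul_pow]
  calc _ ≤ ‖(1 : A)‖ * ((∏ i, K i) * C' ^ (∑ i, (p i).natAbs) *
        ((∑ i, p i).natAbs.factorial * (2 * (Fintype.card ι + 1)) ^ (∑ i, (p i).natAbs))) := by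
          gcongr
          exact prod_factorial_div_le p
    _ = _ := by rw [hp]; ring

end GammaBound

/-! ### Normed copies of finite-dimensional algebras -/

/-- The left regular representation embeds `R` in the normed algebra of operators on `ℂ^d`; its
range inherits the operator norm. -/
theorem exists_normedCommRing_algEquiv (R : Type) [CommRing R] [Algebra ℂ R] [Module.Finite ℂ R] :
    ∃ (A : Type) (_ : NormedCommRing A) (_ : NormedAlgebra ℂ A), FiniteDimensional ℂ A ∧
      Nonempty (R ≃ₐ[ℂ] A) := by
  let V := Fin (Module.finrank ℂ R) → ℂ
  let e : R ≃ₗ[ℂ] V := (Module.finBasis ℂ R).equivFun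
  let ρ : R →ₐ[ℂ] (V →L[ℂ] V) :=
    ((Module.End.toContinuousLinearMap V).toAlgHom.comp
      (e.conjAlgEquiv ℂ).toAlgHom).comp (Algebra.lmul ℂ R)
  have hρ : Function.Injective ρ := by
    have h1 : Function.Injective (Algebra.lmul ℂ R) := Algebra.lmul_injective
    exact ((Module.End.toContinuousLinearMap V).injective.comp
      (e.conjAlgEquiv ℂ).injective).comp h1
  let E := AlgEquiv.ofInjective ρ hρ
  refine ⟨ρ.range, { (inferInstance : NormedRing ρ.range) with
    mul_comm := fun x y => ?_ }, (inferInstance : NormedAlgebra ℂ ρ.range), ?_, ⟨E⟩⟩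
  · obtain ⟨x, rfl⟩ := E.surjective x
    obtain ⟨y, rfl⟩ := E.surjective y
    rw [← map_mul, ← map_mul, mul_comm]
  · exact Module.Finite.equiv E.toLinearEquiv

open Filter Topology

/-! ### Series indexed by words -/

section WordSeries

variable {κ : Type*} [Fintype κ]

theorem summable_pow_word_length {ρ : ℝ} (h0 : 0 ≤ ρ) (h1 : Fintype.card κ * ρ < 1) :
    Summable fun σ : (Σ N : ℕ, Fin N → κ) => ρ ^ σ.1 := by
  classical
  rw [summable_sigma_of_nonneg fun σ => pow_nonneg h0 _]
  refine ⟨fun N => (hasSum_fintype _).summable, ?_⟩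
  have h2 : ∀ N : ℕ, ∑' _ : Fin N → κ, ρ ^ N = (Fintype.card κ * ρ) ^ N := fun N => by
    rw [tsum_fintype, Finset.sum_const, Finset.card_univ, Fintype.card_fun, Fintype.card_fin,
      nsmul_eq_mul, mul_pow]
    push_cast
    rfl
  simp only [h2]
  exact summable_geometric_of_lt_one (by positivity) h1

variable {E : Type*} [NormedAddCommGroup E] [NormedSpace ℂ E] [CompleteSpace E]

/-- The words of length `N` together form the diagonal of an `N`-linear map. There are `(card κ)^N`
of them, which gives the condition on `r`. -/
theorem analyticOnNhd_wordSeries (d : (Σ N : ℕ, Fin N → κ) → E) {K C r : ℝ} (hK : 0 ≤ K)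
    (hC : 0 ≤ C) (hr : 0 < r) (hd : ∀ σ, ‖d σ‖ ≤ K * C ^ σ.1) (hlt : Fintype.card κ * (C * r) < 1) :
    AnalyticOnNhd ℂ (fun z : κ → ℂ => ∑' σ : (Σ N : ℕ, Fin N → κ), (∏ k, z (σ.2 k)) • d σ)
      (Metric.ball 0 r) := by
  classical
  let p : FormalMultilinearSeries ℂ (κ → ℂ) E := fun N => ∑ σ : Fin N → κ,
    ((ContinuousMultilinearMap.mkPiAlgebra ℂ (Fin N) ℂ).compContinuousLinearMap
      (fun k => ContinuousLinearMap.proj (R := ℂ) (φ := fun _ : κ => ℂ) (σ k))).smulRight (d ⟨N, σ⟩)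
  have hp : ∀ N (z : Fin N → κ → ℂ), p N z = ∑ σ : Fin N → κ, (∏ k, z k (σ k)) • d ⟨N, σ⟩ := by
    intro N z
    simp [p]
  have hnorm : ∀ N, ‖p N‖ ≤ K * (Fintype.card κ * C) ^ N := by
    intro N
    refine ContinuousMultilinearMap.opNorm_le_bound (by positivity) fun z => ?_
    rw [hp]
    calc _ ≤ ∑ σ : Fin N → κ, (∏ k, ‖z k‖) * (K * C ^ N) := by
          refine norm_sum_le_of_le _ fun σ _ => ?_
          rw [norm_smul, norm_prod]
          refine mul_le_mul ?_ (hd _) (norm_nonneg _) (by positivity)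
          exact Finset.prod_le_prod (fun _ _ => norm_nonneg _) fun k _ => norm_le_pi_norm _ _
      _ = _ := by
          rw [Finset.sum_const, Finset.card_univ, Fintype.card_fun, Fintype.card_fin,
            nsmul_eq_mul, mul_pow]
          push_cast
          ring
  let r' : NNReal := ⟨r, hr.le⟩
  have hrad : (r' : ENNReal) ≤ p.radius := by
    refine p.le_radius_of_bound K fun N => ?_
    calc ‖p N‖ * r ^ N ≤ K * (Fintype.card κ * C) ^ N * r ^ N := by gcongr; exact hnorm N
      _ = K * (Fintype.card κ * (C * r)) ^ N := by rw [mul_assoc, ← mul_pow]; ring_nf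
      _ ≤ K := mul_le_of_le_one_right hK (pow_le_one₀ (by positivity) hlt.le)
  have hpos : 0 < p.radius := lt_of_lt_of_le (ENNReal.coe_pos.2 hr) hrad
  have han := (p.hasFPowerSeriesOnBall hpos).analyticOnNhd
  have hball : Metric.ball (0 : κ → ℂ) r ⊆ Metric.eball 0 p.radius := by
    have : Metric.ball (0 : κ → ℂ) r = Metric.eball 0 (r' : ENNReal) :=
      (Metric.eball_coe (x := (0 : κ → ℂ)) (ε := r')).symm
    rw [this]
    exact Metric.eball_subset_eball hrad
  refine (han.mono hball).congr Metric.isOpen_ball fun z hz => ?_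
  have hz' : ‖z‖ ≤ r := by
    rw [mem_ball_zero_iff] at hz
    exact hz.le
  have hsum : Summable fun σ : (Σ N : ℕ, Fin N → κ) => (∏ k, z (σ.2 k)) • d σ := by
    refine Summable.of_norm_bounded
      ((summable_pow_word_length (κ := κ) (ρ := C * r) (by positivity) hlt).mul_left K)
      fun σ => ?_
    rw [norm_smul, norm_prod]
    calc (∏ k, ‖z (σ.2 k)‖) * ‖d σ‖ ≤ r ^ σ.1 * (K * C ^ σ.1) := by
          refine mul_le_mul ?_ (hd _) (norm_nonneg _) (by positivity)
          calc _ ≤ ∏ _k : Fin σ.1, r := Finset.prod_le_prod (fun _ _ => norm_nonneg _)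
                fun k _ => (norm_le_pi_norm _ _).trans hz'
            _ = _ := by simp
      _ = K * (C * r) ^ σ.1 := by rw [mul_pow]; ring
  change p.sum z = _
  rw [FormalMultilinearSeries.sum, hsum.tsum_sigma' fun N => (hasSum_fintype _).summable]
  refine tsum_congr fun N => ?_
  rw [hp, tsum_fintype]

end WordSeries

/-! ### Laurent series supported on a finitely generated monoid -/

section Laurent

variable {ι : Type*} [Fintype ι]

/-- The Laurent monomial with exponent `p`. -/
def laurent (a : ι → ℂ) (p : ι → ℤ) : ℂ := ∏ i, a i ^ p i

theorem laurent_add {a : ι → ℂ} (ha : ∀ i, a i ≠ 0) (p q : ι → ℤ) :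
    laurent a (p + q) = laurent a p * laurent a q := by
  simp only [laurent, Pi.add_apply, ← Finset.prod_mul_distrib]
  exact Finset.prod_congr rfl fun i _ => zpow_add₀ (ha i) _ _

theorem laurent_sum {a : ι → ℂ} (ha : ∀ i, a i ≠ 0) {J : Type*} (s : Finset J) (p : J → ι → ℤ) :
    laurent a (∑ j ∈ s, p j) = ∏ j ∈ s, laurent a (p j) := by
  classical
  induction s using Finset.induction_on with
  | empty => simp [laurent]
  | insert j s hj ih => rw [Finset.sum_insert hj, Finset.prod_insert hj, laurent_add ha, ih]

theorem laurent_single [DecidableEq ι] (a : ι → ℂ) (i : ι) (k : ℤ) :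
    laurent a (Pi.single i k) = a i ^ k := by
  rw [laurent, Finset.prod_eq_single i]
  · simp
  · intro j _ hj
    simp [hj]
  · simp

theorem analyticAt_laurent {a : ι → ℂ} (ha : ∀ i, a i ≠ 0) (p : ι → ℤ) :
    AnalyticAt ℂ (fun b => laurent b p) a := by
  refine Finset.analyticAt_fun_prod _ fun i _ => ?_
  exact AnalyticAt.zpow ((ContinuousLinearMap.proj (R := ℂ) (φ := fun _ : ι => ℂ) i).analyticAt a)
    (ha i)

theorem hasDerivAt_laurent_line [DecidableEq ι] {a : ι → ℂ} (v : ι) (p : ι → ℤ) {t : ℂ}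
    (ha : ∀ i, (a + t • (Pi.single v (1 : ℂ) : ι → ℂ)) i ≠ 0) :
    HasDerivAt (fun t : ℂ => laurent (a + t • Pi.single v (1 : ℂ)) p)
      ((p v : ℂ) * laurent (a + t • Pi.single v (1 : ℂ)) (p - Pi.single v 1)) t := by
  have hform : ∀ (t : ℂ) (q : ι → ℤ), laurent (a + t • Pi.single v (1 : ℂ)) q =
      (a v + t) ^ q v * ∏ i ∈ Finset.univ.erase v, a i ^ q i := by
    intro t q
    rw [laurent, ← Finset.mul_prod_erase _ _ (Finset.mem_univ v)]
    congr 1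
    · simp
    · refine Finset.prod_congr rfl fun i hi => ?_
      simp [Finset.ne_of_mem_erase hi]
  simp only [hform]
  have hv : a v + t ≠ 0 := by simpa using ha v
  have h1 : HasDerivAt (fun t : ℂ => (a v + t) ^ p v) ((p v : ℂ) * (a v + t) ^ (p v - 1)) t := by
    have h2 := (hasDerivAt_zpow (p v) (a v + t) (Or.inl hv)).comp t
      ((hasDerivAt_id t).const_add (a v))
    exact h2.congr_deriv (by simp)
  refine (h1.mul_const (∏ i ∈ Finset.univ.erase v, a i ^ p i)).congr_deriv ?_
  rw [mul_assoc]
  congr 2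
  · simp
  · refine Finset.prod_congr rfl fun i hi => ?_
    simp [Finset.ne_of_mem_erase hi]

variable {κ : Type*}

/-- The part of the torus where the monomials with exponents `g k` are smaller than `ε`. -/
def smallRegion (g : κ → ι → ℤ) (ε : ℝ) : Set (ι → ℂ) :=
  {a | (∀ i, a i ≠ 0) ∧ ∀ k, ‖laurent a (g k)‖ < ε}

theorem isOpen_smallRegion [Finite κ] (g : κ → ι → ℤ) (ε : ℝ) : IsOpen (smallRegion g ε) := by
  rw [isOpen_iff_mem_nhds]
  rintro a ⟨ha, hg⟩
  have h1 : ∀ᶠ b in 𝓝 a, ∀ i, b i ≠ 0 :=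
    eventually_all.2 fun i => (continuous_apply i).continuousAt.eventually_ne (ha i)
  have h2 : ∀ᶠ b in 𝓝 a, ∀ k, ‖laurent b (g k)‖ < ε :=
    eventually_all.2 fun k =>
      (analyticAt_laurent ha (g k)).continuousAt.norm.eventually_lt_const (hg k)
  filter_upwards [h1, h2] with b hb1 hb2 using ⟨hb1, hb2⟩

/-- The sum of the exponents in a word. -/
def wordSum (g : κ → ι → ℤ) (σ : Σ N : ℕ, Fin N → κ) : ι → ℤ := ∑ k, g (σ.2 k)

theorem laurent_wordSum {a : ι → ℂ} (ha : ∀ i, a i ≠ 0) (g : κ → ι → ℤ)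
    (σ : Σ N : ℕ, Fin N → κ) : laurent a (wordSum g σ) = ∏ k, laurent a (g (σ.2 k)) :=
  laurent_sum ha _ _

theorem norm_laurent_wordSum_le {g : κ → ι → ℤ} {ε : ℝ} {a : ι → ℂ} (ha : a ∈ smallRegion g ε)
    (σ : Σ N : ℕ, Fin N → κ) : ‖laurent a (wordSum g σ)‖ ≤ ε ^ σ.1 := by
  rw [laurent_wordSum ha.1, norm_prod]
  calc _ ≤ ∏ _k : Fin σ.1, ε := Finset.prod_le_prod (fun _ _ => norm_nonneg _)
        fun k _ => (ha.2 _).le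
    _ = _ := by simp

variable [Fintype κ]

/-- The total size of the entries of the generators. -/
def genSize (g : κ → ι → ℤ) : ℕ := ∑ k, ∑ i, (g k i).natAbs

theorem sum_natAbs_wordSum_le (g : κ → ι → ℤ) (σ : Σ N : ℕ, Fin N → κ) :
    ∑ i, (wordSum g σ i).natAbs ≤ σ.1 * genSize g := by
  calc ∑ i, (wordSum g σ i).natAbs ≤ ∑ i, ∑ k, (g (σ.2 k) i).natAbs := by
        refine Finset.sum_le_sum fun i _ => ?_
        rw [wordSum, Finset.sum_apply]
        exact Int.natAbs_sum_le _ _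
    _ = ∑ k, ∑ i, (g (σ.2 k) i).natAbs := Finset.sum_comm
    _ ≤ ∑ _k : Fin σ.1, genSize g := Finset.sum_le_sum fun k _ =>
        Finset.single_le_sum (f := fun k => ∑ i, (g k i).natAbs) (fun _ _ => Nat.zero_le _)
          (Finset.mem_univ _)
    _ = _ := by simp

variable {E : Type*} [NormedAddCommGroup E]

/-- The coefficients `c p`, `p ∈ S`, grow at most exponentially with rate `C`, and are supported
on a translate of the monoid generated by `g`. -/
def IsDominated (g : κ → ι → ℤ) (C : ℝ) (S : Set (ι → ℤ)) (c : (ι → ℤ) → E) : Prop :=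
  ∃ (m : ι → ℤ) (K : ℝ), 0 ≤ K ∧ ∀ p ∈ S, c p ≠ 0 →
    (∃ σ, wordSum g σ = p + m) ∧ ‖c p‖ ≤ K * C ^ (∑ i, (p i).natAbs)

variable {g : κ → ι → ℤ} {C ε : ℝ} {S : Set (ι → ℤ)} {c : (ι → ℤ) → E}

/-- One word is fixed for each exponent. The size of `p` is at most linear in the length of its
word, so the bound becomes geometric in that length; the shift `m` goes into `K`. -/
theorem IsDominated.exists_word (h : IsDominated g C S c) (hC : 1 ≤ C) :
    ∃ (m : ι → ℤ) (K : ℝ) (w : (ι → ℤ) → (Σ N : ℕ, Fin N → κ)), 0 ≤ K ∧ ∀ p ∈ S, c p ≠ 0 →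
      wordSum g (w p) = p + m ∧ ‖c p‖ ≤ K * (C ^ genSize g) ^ (w p).1 := by
  classical
  obtain ⟨m, K, hK, h⟩ := h
  have hex : ∀ p : ι → ℤ, ∃ σ : (Σ N : ℕ, Fin N → κ), p ∈ S → c p ≠ 0 → wordSum g σ = p + m := by
    intro p
    by_cases hp : p ∈ S ∧ c p ≠ 0
    · obtain ⟨σ, hσ⟩ := (h p hp.1 hp.2).1
      exact ⟨σ, fun _ _ => hσ⟩
    · exact ⟨⟨0, Fin.elim0⟩, fun h1 h2 => (hp ⟨h1, h2⟩).elim⟩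
  choose w hw using hex
  refine ⟨m, K * C ^ (∑ i, (m i).natAbs), w, by positivity, fun p hp hc => ⟨hw p hp hc, ?_⟩⟩
  refine (h p hp hc).2.trans ?_
  have h1 : ∑ i, (p i).natAbs ≤ (∑ i, (m i).natAbs) + (w p).1 * genSize g := by
    have h2 := sum_natAbs_wordSum_le g (w p)
    rw [hw p hp hc] at h2
    have h3 : ∑ i, (p i).natAbs ≤ ∑ i, (((p + m) i).natAbs + (m i).natAbs) :=
      Finset.sum_le_sum fun i _ => by simp only [Pi.add_apply]; omega
    rw [Finset.sum_add_distrib] at h3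
    omega
  calc K * C ^ (∑ i, (p i).natAbs) ≤ K * C ^ ((∑ i, (m i).natAbs) + (w p).1 * genSize g) := by
        gcongr
    _ = _ := by rw [pow_add, mul_comm (w p).1, pow_mul]; ring

variable [NormedSpace ℂ E]

/-- A word determines its exponent, so the terms inject into the summable word series. The majorant
separates into one monomial in `a` and a sequence free of `a`, as termwise differentiation requires.
-/
theorem IsDominated.exists_bound (h : IsDominated g C S c) (hC : 1 ≤ C) (hε : 0 ≤ ε)
    (hlt : Fintype.card κ * (C ^ genSize g * ε) < 1) :
    ∃ (m : ι → ℤ) (u : S → ℝ), Summable u ∧ (∀ p, 0 ≤ u p) ∧ ∀ a ∈ smallRegion g ε, ∀ p : S,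
      ‖laurent a p • c p‖ ≤ ‖laurent a m‖ * u p := by
  classical
  obtain ⟨m, K, w, hK, h⟩ := h.exists_word hC
  have hρ : 0 ≤ C ^ genSize g * ε := by positivity
  let s : Set S := {p | c p ≠ 0}
  refine ⟨-m, s.indicator fun p => K * (C ^ genSize g * ε) ^ (w p).1, ?_, ?_, ?_⟩
  · rw [← summable_subtype_iff_indicator]
    refine Summable.mul_left K ?_
    refine (summable_pow_word_length (κ := κ) hρ hlt).comp_injective
      (i := fun p : s => w (p : S)) ?_
    intro p q hpq
    have h1 := (h _ p.1.2 p.2).1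
    have h2 := (h _ q.1.2 q.2).1
    simp only at hpq
    rw [hpq, h2] at h1
    exact Subtype.ext (Subtype.ext (add_right_cancel h1.symm))
  · intro p
    exact Set.indicator_nonneg (fun _ _ => by positivity) _
  · intro a ha p
    by_cases hp : c p = 0
    · rw [hp, smul_zero, norm_zero]
      exact mul_nonneg (norm_nonneg _) (Set.indicator_nonneg (fun _ _ => by positivity) _)
    · have hps : p ∈ s := hp
      obtain ⟨h1, h2⟩ := h _ p.2 hp
      rw [Set.indicator_of_mem hps, norm_smul]
      have h3 : (p : ι → ℤ) = -m + wordSum g (w p) := by rw [h1]; abel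
      have h4 : ‖laurent a p‖ ≤ ‖laurent a (-m)‖ * ε ^ (w p).1 := by
        conv_lhs => rw [h3]
        rw [laurent_add ha.1, norm_mul]
        gcongr
        exact norm_laurent_wordSum_le ha _
      calc _ ≤ (‖laurent a (-m)‖ * ε ^ (w p).1) * (K * (C ^ genSize g) ^ (w p).1) := by gcongr
        _ = _ := by rw [mul_pow]; ring

variable [CompleteSpace E]

theorem IsDominated.summable (h : IsDominated g C S c) (hC : 1 ≤ C) (hε : 0 ≤ ε)
    (hlt : Fintype.card κ * (C ^ genSize g * ε) < 1) {a : ι → ℂ} (ha : a ∈ smallRegion g ε) :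
    Summable fun p : S => laurent a p • c p := by
  obtain ⟨m, u, hu, -, hle⟩ := h.exists_bound hC hε hlt
  exact Summable.of_norm_bounded (hu.mul_left _) (hle a ha)

theorem IsDominated.analyticOnNhd (h : IsDominated g C S c) (hC : 1 ≤ C) (hε : 0 < ε)
    (hlt : Fintype.card κ * (C ^ genSize g * ε) < 1) :
    AnalyticOnNhd ℂ (fun a => ∑' p : S, laurent a p • c p) (smallRegion g ε) := by
  classical
  obtain ⟨m, K, w, hK, h⟩ := h.exists_word hC
  -- Different words may have the same sum. Only the chosen word carries the coefficient, so each
  -- exponent is counted once.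
  let P : (Σ N : ℕ, Fin N → κ) → Prop := fun σ =>
    wordSum g σ - m ∈ S ∧ c (wordSum g σ - m) ≠ 0 ∧ w (wordSum g σ - m) = σ
  let d : (Σ N : ℕ, Fin N → κ) → E := fun σ => if P σ then c (wordSum g σ - m) else 0
  have hd : ∀ σ, ‖d σ‖ ≤ K * (C ^ genSize g) ^ σ.1 := by
    intro σ
    by_cases hσ : P σ
    · simp only [d, if_pos hσ]
      have := (h _ hσ.1 hσ.2.1).2
      rwa [hσ.2.2] at this
    · simp only [d, if_neg hσ, norm_zero]
      positivity
  have hG := analyticOnNhd_wordSeries d hK (by positivity) hε hd hlt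
  have hz : AnalyticOnNhd ℂ (fun (a : ι → ℂ) k => laurent a (g k)) (smallRegion g ε) := by
    intro a ha
    exact AnalyticAt.pi fun k => analyticAt_laurent ha.1 _
  have hmaps : Set.MapsTo (fun (a : ι → ℂ) k => laurent a (g k)) (smallRegion g ε)
      (Metric.ball 0 ε) := by
    intro a ha
    rw [mem_ball_zero_iff, pi_norm_lt_iff hε]
    exact ha.2
  have hcomp := hG.comp hz hmaps
  have hm : AnalyticOnNhd ℂ (fun a : ι → ℂ => laurent a (-m)) (smallRegion g ε) :=
    fun a ha => analyticAt_laurent ha.1 _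
  refine (hm.smul hcomp).congr (isOpen_smallRegion g ε) fun a ha => ?_
  simp only [Function.comp_apply]
  rw [← tsum_const_smul'']
  symm
  have hval : ∀ σ, (laurent a (-m)) • ((∏ k, laurent a (g (σ.2 k))) • d σ) =
      laurent a (wordSum g σ - m) • d σ := by
    intro σ
    rw [smul_smul, ← laurent_wordSum ha.1, ← laurent_add ha.1]
    congr 2
    abel
  simp only [hval]
  refine tsum_eq_tsum_of_ne_zero_bij
    (g := fun σ => laurent a (wordSum g σ - m) • d σ)
    (fun σ => ⟨wordSum g σ.1 - m, ?_⟩) ?_ ?_ ?_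
  · have h1 : d σ.1 ≠ 0 := right_ne_zero_of_smul σ.2
    by_contra h2
    exact h1 (if_neg fun h3 => h2 h3.1)
  · intro σ τ hστ
    have hP : ∀ σ : Function.support fun σ => laurent a (wordSum g σ - m) • d σ, P σ.1 := by
      intro σ
      have h1 : d σ.1 ≠ 0 := right_ne_zero_of_smul σ.2
      by_contra h2
      exact h1 (if_neg h2)
    have h1 : wordSum g σ.1 - m = wordSum g τ.1 - m := congrArg Subtype.val hστ
    have h2 := (hP σ).2.2
    rw [h1, (hP τ).2.2] at h2
    exact Subtype.ext h2.symm
  · intro p hp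
    have hc : c p ≠ 0 := right_ne_zero_of_smul hp
    have hw := (h _ p.2 hc).1
    have hw' : wordSum g (w p) - m = p := by rw [hw]; abel
    have hPw : P (w p) := ⟨by rw [hw']; exact p.2, by rw [hw']; exact hc, by rw [hw']⟩
    refine ⟨⟨w p, ?_⟩, Subtype.ext hw'⟩
    simp only [Function.mem_support, d, if_pos hPw, hw']
    exact hp
  · intro σ
    have h1 : d σ.1 ≠ 0 := right_ne_zero_of_smul σ.2
    have h2 : P σ.1 := by
      by_contra h2
      exact h1 (if_neg h2)
    simp only [d, if_pos h2]

theorem IsDominated.hasSum_lineDeriv [DecidableEq ι] (h : IsDominated g C S c) (hC : 1 ≤ C)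
    (hε : 0 < ε) (hlt : Fintype.card κ * (C ^ genSize g * ε) < 1) {a : ι → ℂ}
    (ha : a ∈ smallRegion g ε) (v : ι) :
    HasSum (fun p : S => ((p.1 v : ℂ) * laurent a (p.1 - Pi.single v 1)) • c p)
      (lineDeriv ℂ (fun b => ∑' p : S, laurent b p • c p) a (Pi.single v 1)) := by
  obtain ⟨m, u, hu, hu0, hle⟩ := h.exists_bound hC hε.le hlt
  -- Here the monomial in the majorant is bounded by a constant, so the majorant is uniform near
  -- `a`.
  let W : Set (ι → ℂ) := smallRegion g ε ∩ {b | ‖laurent b m‖ < ‖laurent a m‖ + 1}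
  have hW : W ∈ 𝓝 a := by
    refine Filter.inter_mem ((isOpen_smallRegion g ε).mem_nhds ha) ?_
    exact (analyticAt_laurent ha.1 m).continuousAt.norm.eventually_lt_const (lt_add_one _)
  have hline : Continuous fun t : ℂ => a + t • (Pi.single v (1 : ℂ) : ι → ℂ) := by fun_prop
  obtain ⟨V, hVW, hVo, haV⟩ := mem_nhds_iff.1 hW
  let L : Set ℂ := (fun t : ℂ => a + t • (Pi.single v (1 : ℂ) : ι → ℂ)) ⁻¹' V
  have hL : IsOpen L := hVo.preimage hline
  have h0L : (0 : ℂ) ∈ L := by simpa [L] using haV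
  have key := Complex.hasSum_deriv_of_summable_norm (U := L) (z := 0)
    (F := fun (p : S) (t : ℂ) => laurent (a + t • (Pi.single v (1 : ℂ) : ι → ℂ)) p • c p)
    (hu.mul_left (‖laurent a m‖ + 1)) ?_ hL ?_ h0L
  · rw [lineDeriv]
    convert key using 2 with p
    have h2 : ∀ i, (a + (0 : ℂ) • (Pi.single v (1 : ℂ) : ι → ℂ)) i ≠ 0 := fun i => by simpa using ha.1 i
    have h1 := (hasDerivAt_laurent_line (a := a) v p.1 h2).smul_const (c p)
    simpa using h1.deriv.symm
  · intro p t ht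
    exact ((hasDerivAt_laurent_line v p.1 (hVW ht).1.1).smul_const
      (c p)).differentiableAt.differentiableWithinAt
  · intro p t ht
    refine (hle _ (hVW ht).1 p).trans ?_
    exact mul_le_mul_of_nonneg_right (le_of_lt (hVW ht).2) (hu0 p)

end Laurent

/-! ### The exponential factor -/

section ExpFactor

variable {ι : Type*} {U : Set (ι → ℂ)} {lg : (ι → ℂ) → (ι → ℂ)}

/-- By continuity `lg b v - lg a v` has imaginary part in `(-π, π)` near `a`, where the principal
logarithm inverts `exp`. Analyticity of a merely continuous branch follows. -/
theorem eventually_branch_eq (hU : IsOpen U) (hlg : ContinuousOn lg U)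
    (hexp : ∀ a ∈ U, ∀ v, Complex.exp (lg a v) = a v) {a : ι → ℂ} (ha : a ∈ U) (v : ι) :
    ∀ᶠ b in 𝓝 a, lg b v = lg a v + Complex.log (b v / a v) := by
  have hav : a v ≠ 0 := by rw [← hexp a ha v]; exact Complex.exp_ne_zero _
  have hc : ContinuousAt (fun b => lg b v - lg a v) a :=
    ((continuous_apply v).continuousAt.comp (hlg.continuousAt (hU.mem_nhds ha))).sub
      continuousAt_const
  have him : ContinuousAt (fun b => (lg b v - lg a v).im) a :=
    Complex.continuous_im.continuousAt.comp hc
  have h1 : ∀ᶠ b in 𝓝 a, -Real.pi < (lg b v - lg a v).im :=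
    him.eventually_const_lt (by simpa using Real.pi_pos)
  have h2 : ∀ᶠ b in 𝓝 a, (lg b v - lg a v).im < Real.pi :=
    him.eventually_lt_const (by simpa using Real.pi_pos)
  filter_upwards [h1, h2, hU.mem_nhds ha] with b hb1 hb2 hbU
  have h3 : b v / a v = Complex.exp (lg b v - lg a v) := by
    rw [Complex.exp_sub, hexp a ha, hexp b hbU]
  rw [h3, Complex.log_exp hb1 hb2.le]
  ring

theorem analyticAt_branch [Fintype ι] (hU : IsOpen U) (hlg : ContinuousOn lg U)
    (hexp : ∀ a ∈ U, ∀ v, Complex.exp (lg a v) = a v) {a : ι → ℂ} (ha : a ∈ U) (v : ι) :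
    AnalyticAt ℂ (fun b => lg b v) a := by
  have hav : a v ≠ 0 := by rw [← hexp a ha v]; exact Complex.exp_ne_zero _
  have hp : AnalyticAt ℂ (fun b : ι → ℂ => b v) a :=
    (ContinuousLinearMap.proj (R := ℂ) (φ := fun _ : ι => ℂ) v).analyticAt a
  have h : AnalyticAt ℂ (fun b : ι → ℂ => lg a v + Complex.log (b v / a v)) a := by
    refine analyticAt_const.add ((hp.div analyticAt_const hav).clog ?_)
    simp [div_self hav]
  exact h.congr ((eventually_branch_eq hU hlg hexp ha v).mono fun b hb => hb.symm)

theorem hasDerivAt_branch_line [DecidableEq ι] (hU : IsOpen U) (hlg : ContinuousOn lg U)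
    (hexp : ∀ a ∈ U, ∀ v, Complex.exp (lg a v) = a v) {a : ι → ℂ} (ha : a ∈ U) (v w : ι) :
    HasDerivAt (fun t : ℂ => lg (a + t • (Pi.single v (1 : ℂ) : ι → ℂ)) w)
      (if w = v then (a v)⁻¹ else 0) 0 := by
  have haw : a w ≠ 0 := by rw [← hexp a ha w]; exact Complex.exp_ne_zero _
  have hline : ContinuousAt (fun t : ℂ => a + t • (Pi.single v (1 : ℂ) : ι → ℂ)) 0 := by fun_prop
  have hev : ∀ᶠ t : ℂ in 𝓝 0, lg (a + t • (Pi.single v (1 : ℂ) : ι → ℂ)) w =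
      lg a w + Complex.log ((a + t • (Pi.single v (1 : ℂ) : ι → ℂ)) w / a w) := by
    have h0 : a + (0 : ℂ) • (Pi.single v (1 : ℂ) : ι → ℂ) = a := by simp
    have hline' : Tendsto (fun t : ℂ => a + t • (Pi.single v (1 : ℂ) : ι → ℂ)) (𝓝 0) (𝓝 a) := by
      simpa only [h0] using hline.tendsto
    exact hline'.eventually (eventually_branch_eq hU hlg hexp ha w)
  refine HasDerivAt.congr_of_eventuallyEq ?_ hev
  by_cases hwv : w = v
  · subst hwv
    have h1 : HasDerivAt (fun t : ℂ => (a w + t) / a w) (1 / a w) 0 :=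
      ((hasDerivAt_id (0 : ℂ)).const_add (a w)).div_const (a w)
    have h2 : (a w + 0) / a w ∈ Complex.slitPlane := by simp [div_self haw]
    have h3 := (h1.clog h2).const_add (lg a w)
    simpa [haw] using h3
  · simpa [hwv] using hasDerivAt_const (0 : ℂ) (lg a w + Complex.log (a w / a w))

variable [Fintype ι] {A : Type*} [NormedCommRing A] [NormedAlgebra ℂ A] [CompleteSpace A]

/-- The factor `∏ a_v ^ D_v = exp (∑ log a_v • D_v)`. -/
def expFactor (lg : (ι → ℂ) → (ι → ℂ)) (D : ι → A) (a : ι → ℂ) : A :=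
  NormedSpace.exp (∑ v, lg a v • D v)

theorem analyticAt_expFactor (hU : IsOpen U) (hlg : ContinuousOn lg U)
    (hexp : ∀ a ∈ U, ∀ v, Complex.exp (lg a v) = a v) (D : ι → A) {a : ι → ℂ} (ha : a ∈ U) :
    AnalyticAt ℂ (expFactor lg D) a := by
  have h : AnalyticAt ℂ (fun b => ∑ v, lg b v • D v) a :=
    Finset.analyticAt_fun_sum _ fun v _ =>
      (analyticAt_branch hU hlg hexp ha v).smul analyticAt_const
  exact AnalyticAt.fun_comp (f := fun b => ∑ v, lg b v • D v)
    (NormedSpace.exp_analytic (𝕂 := ℂ) (∑ v, lg a v • D v)) h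

theorem hasDerivAt_expFactor_line [DecidableEq ι] (hU : IsOpen U) (hlg : ContinuousOn lg U)
    (hexp : ∀ a ∈ U, ∀ v, Complex.exp (lg a v) = a v) (D : ι → A) {a : ι → ℂ} (ha : a ∈ U) (v : ι) :
    HasDerivAt (fun t : ℂ => expFactor lg D (a + t • (Pi.single v (1 : ℂ) : ι → ℂ)))
      ((a v)⁻¹ • (D v * expFactor lg D a)) 0 := by
  have h : HasDerivAt (fun t : ℂ => ∑ w, lg (a + t • (Pi.single v (1 : ℂ) : ι → ℂ)) w • D w)
      ((a v)⁻¹ • D v) 0 := by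
    have h1 := HasDerivAt.fun_sum (u := Finset.univ) fun w (_ : w ∈ Finset.univ) =>
      (hasDerivAt_branch_line hU hlg hexp ha v w).smul_const (D w)
    refine h1.congr_deriv ?_
    simp [ite_smul]
  have h2 := (hasFDerivAt_exp (𝕂 := ℂ)
    (x := ∑ w, lg (a + (0 : ℂ) • (Pi.single v (1 : ℂ) : ι → ℂ)) w • D w)).comp_hasDerivAt (0 : ℂ) h
  refine h2.congr_deriv ?_
  simp [expFactor, mul_comm]

end ExpFactor

/-! ### Gamma series -/

theorem _root_.HasSum.congr_terms {α β : Type*} [AddCommMonoid α] [TopologicalSpace α]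
    {f f' : β → α} {x : α} (h : HasSum f x) (hf : ∀ b, f' b = f b) : HasSum f' x := by
  rwa [funext hf]

theorem _root_.HasSum.congr_sum {α β : Type*} [AddCommMonoid α] [TopologicalSpace α]
    {f : β → α} {x y : α} (h : HasSum f x) (hx : y = x) : HasSum f y := hx ▸ h

theorem laurent_sub_single {ι : Type*} [Fintype ι] [DecidableEq ι] {a : ι → ℂ}
    (ha : ∀ i, a i ≠ 0) (p : ι → ℤ) (v : ι) :
    laurent a (p - Pi.single v 1) = laurent a p * (a v)⁻¹ := by
  rw [sub_eq_add_neg, laurent_add ha, ← Pi.single_neg, laurent_single, zpow_neg_one]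


section GammaSeries

variable {ι κ : Type*} [Fintype ι] [Fintype κ] {A : Type*} [NormedCommRing A]
  [NormedAlgebra ℂ A] [CompleteSpace A] {g : κ → ι → ℤ} {C ε : ℝ} {D : ι → A}
  {U : Set (ι → ℂ)} {lg : (ι → ℂ) → (ι → ℂ)} {Λ : Type*} [AddCommGroup Λ]

/-- The gamma series of the exponents `p` with image `d` under `deg`. -/
def gammaSeries (D : ι → A) (lg : (ι → ℂ) → (ι → ℂ)) (deg : (ι → ℤ) →+ Λ) (d : Λ) (a : ι → ℂ) : A :=
  (∑' p : {p : ι → ℤ | deg p = d}, laurent a p.1 • gammaCoeff D p.1) * expFactor lg D a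

variable {deg : (ι → ℤ) →+ Λ} {d : Λ}

theorem analyticOnNhd_gammaSeries (hC : 1 ≤ C) (hε : 0 < ε)
    (hlt : Fintype.card κ * (C ^ genSize g * ε) < 1) (hU : IsOpen U) (hUg : U ⊆ smallRegion g ε)
    (hlg : ContinuousOn lg U) (hexp : ∀ a ∈ U, ∀ v, Complex.exp (lg a v) = a v)
    (hd : IsDominated g C {p | deg p = d} (gammaCoeff D)) :
    AnalyticOnNhd ℂ (gammaSeries D lg deg d) U := fun a ha =>
  (hd.analyticOnNhd hC hε hlt a (hUg ha)).mul (analyticAt_expFactor hU hlg hexp D ha)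

variable [DecidableEq ι]

/-- By the product rule the Laurent monomial contributes `p_v` and the exponential factor
contributes `D_v`. -/
theorem hasSum_lineDeriv_gammaSeries (hC : 1 ≤ C) (hε : 0 < ε)
    (hlt : Fintype.card κ * (C ^ genSize g * ε) < 1) (hU : IsOpen U) (hUg : U ⊆ smallRegion g ε)
    (hlg : ContinuousOn lg U) (hexp : ∀ a ∈ U, ∀ v, Complex.exp (lg a v) = a v)
    (hd : IsDominated g C {p | deg p = d} (gammaCoeff D)) {a : ι → ℂ} (ha : a ∈ U) (v : ι) :
    HasSum (fun p : {p : ι → ℤ | deg p = d} => (laurent a (p.1 - Pi.single v 1) •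
      ((D v + ((p.1 v : ℤ) : A)) * gammaCoeff D p.1)) * expFactor lg D a)
      (lineDeriv ℂ (gammaSeries D lg deg d) a (Pi.single v 1)) := by
  have haS := hUg ha
  have h1 := (hd.hasSum_lineDeriv hC hε hlt haS v).mul_right (expFactor lg D a)
  have h2 := ((hd.summable hC hε.le hlt haS).hasSum.mul_right
    ((a v)⁻¹ • (D v * expFactor lg D a)))
  have h3 := h1.add h2
  have hdiff : DifferentiableAt ℂ
      (fun b => ∑' p : {p : ι → ℤ | deg p = d}, laurent b p.1 • gammaCoeff D p.1) a :=
    (hd.analyticOnNhd hC hε hlt a haS).differentiableAt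
  have h4 := hdiff.lineDifferentiableAt (v := Pi.single v 1)
  have h5 := HasDerivAt.mul h4.hasDerivAt (hasDerivAt_expFactor_line hU hlg hexp D ha v)
  have h6 := h5.deriv
  have h7 : lineDeriv ℂ (gammaSeries D lg deg d) a (Pi.single v 1) = _ := h6
  rw [h7]
  refine (h3.congr_terms fun p => ?_).congr_sum ?_
  · simp only [Algebra.smul_def, map_mul, map_intCast, laurent_sub_single haS.1]
    ring
  · simp [lineDeriv]

/-- The functional equation turns `D_v + p_v` times the coefficient at `p` into the coefficient at
`p - e_v`, and `p ↦ p - e_v` is a bijection between the two degree fibres. -/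
theorem lineDeriv_gammaSeries (hC : 1 ≤ C) (hε : 0 < ε)
    (hlt : Fintype.card κ * (C ^ genSize g * ε) < 1) (hU : IsOpen U) (hUg : U ⊆ smallRegion g ε)
    (hlg : ContinuousOn lg U) (hexp : ∀ a ∈ U, ∀ v, Complex.exp (lg a v) = a v)
    (hD : ∀ i, IsNilpotent (D i))
    (hd : IsDominated g C {p | deg p = d} (gammaCoeff D))
    {a : ι → ℂ} (ha : a ∈ U) (v : ι)
    (hd' : IsDominated g C {p | deg p = d - deg (Pi.single v 1)} (gammaCoeff D)) :
    lineDeriv ℂ (gammaSeries D lg deg d) a (Pi.single v 1) =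
      gammaSeries D lg deg (d - deg (Pi.single v 1)) a := by
  have h1 := hasSum_lineDeriv_gammaSeries hC hε hlt hU hUg hlg hexp hd ha v
  have h2 := (hd'.summable hC hε.le hlt (hUg ha)).hasSum.mul_right (expFactor lg D a)
  let e : {p : ι → ℤ | deg p = d} ≃ {p : ι → ℤ | deg p = d - deg (Pi.single v 1)} :=
    (Equiv.subRight (Pi.single v (1 : ℤ) : ι → ℤ)).subtypeEquiv fun p => by
      simp [map_sub]
  refine h1.unique ((e.hasSum_iff.2 h2).congr_terms fun p => ?_)
  have h3 : (e p : ι → ℤ) = p.1 - Pi.single v 1 := rfl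
  simp only [Function.comp_apply, h3, add_mul_gammaCoeff hD]

theorem sum_mul_lineDeriv_gammaSeries (hC : 1 ≤ C) (hε : 0 < ε)
    (hlt : Fintype.card κ * (C ^ genSize g * ε) < 1) (hU : IsOpen U) (hUg : U ⊆ smallRegion g ε)
    (hlg : ContinuousOn lg U) (hexp : ∀ a ∈ U, ∀ v, Complex.exp (lg a v) = a v)
    (hd : IsDominated g C {p | deg p = d} (gammaCoeff D))
    {a : ι → ℂ} (ha : a ∈ U) (c : ι → ℤ) (s : ℤ) (hc : ∑ v, (c v : A) * D v = 0)
    (hs : ∀ p, deg p = d → ∑ v, c v * p v = s) :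
    ∑ v, ((c v : ℂ) * a v) • lineDeriv ℂ (gammaSeries D lg deg d) a (Pi.single v 1) =
      (s : ℂ) • gammaSeries D lg deg d a := by
  have haS := hUg ha
  have h1 := hasSum_sum fun v (_ : v ∈ Finset.univ) =>
    (hasSum_lineDeriv_gammaSeries hC hε hlt hU hUg hlg hexp hd ha v).const_smul ((c v : ℂ) * a v)
  have h2 := ((hd.summable hC hε.le hlt haS).hasSum.mul_right (expFactor lg D a)).const_smul (s : ℂ)
  refine h1.unique (h2.congr_terms fun p => ?_)
  have h3 : ∑ v, (c v : A) * ((p.1 v : ℤ) : A) = (s : A) := by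
    rw [← hs p.1 p.2]
    push_cast
    rfl
  have h4 : (s : A) = ∑ v, (c v : A) * (D v + ((p.1 v : ℤ) : A)) := by
    simp only [mul_add, Finset.sum_add_distrib, hc, h3, zero_add]
  simp only [Algebra.smul_def, map_intCast, map_mul, h4, Finset.sum_mul]
  refine Finset.sum_congr rfl fun v _ => ?_
  rw [laurent_sub_single haS.1, map_mul]
  have h5 : algebraMap ℂ A (a v) * algebraMap ℂ A (a v)⁻¹ = 1 := by
    rw [← map_mul, mul_inv_cancel₀ (haS.1 v), map_one]
  linear_combination ((c v : A) * (D v + ((p.1 v : ℤ) : A)) * algebraMap ℂ A (laurent a p.1) *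
    gammaCoeff D p.1 * expFactor lg D a) * h5

end GammaSeries

/-! ### Facets of a regular projective triangulation -/

section Facets

variable {n : ℕ} {P : ReflexivePolytope n}

theorem latt_injective : Function.Injective (latt : (Fin n → ℤ) → Fin n → ℝ) := by
  intro v w h
  funext i
  have := congrFun h i
  simpa [latt] using this

theorem latt_zsmul (k : ℤ) (v : Fin n → ℤ) : latt (k • v) = (k : ℝ) • latt v := by
  ext; simp [latt]

theorem latt_zero : latt (0 : Fin n → ℤ) = 0 := by ext; simp [latt]

theorem latt_sum {J : Type*} (s : Finset J) (f : J → Fin n → ℤ) :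
    latt (∑ j ∈ s, f j) = ∑ j ∈ s, latt (f j) := by
  ext i
  simp [latt, Finset.sum_apply]

@[simp] theorem latt_eq_zero {v : Fin n → ℤ} : latt v = 0 ↔ v = 0 := by
  rw [← latt_zero, latt_injective.eq_iff]

theorem latt_dotProduct (x y : Fin n → ℤ) : latt x ⬝ᵥ latt y = ((x ⬝ᵥ y : ℤ) : ℝ) := by
  simp [latt, dotProduct]

@[simp] theorem origin_val : (P.origin : P.Point).1 = 0 := rfl

theorem ReflexivePolytope.convex_carrier (P : ReflexivePolytope n) : Convex ℝ P.carrier := by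
  obtain ⟨V, hV⟩ := P.isLatticePolytope
  rw [hV]
  exact convex_convexHull ℝ _

namespace RegularProjectiveTriangulation

variable (T : RegularProjectiveTriangulation P.carrier)

theorem exists_point_of_mem_face {s : Finset (Fin n → ℝ)} (hs : s ∈ T.complex.faces)
    {x : Fin n → ℝ} (hx : x ∈ s) : ∃ v : P.Point, latt v.1 = x := by
  have hv : x ∈ T.complex.vertices :=
    T.complex.down_closed hs (by simpa using hx) (by simp)
  obtain ⟨v, rfl⟩ := T.vertices_integral x hv
  refine ⟨⟨v, ?_⟩, rfl⟩
  rw [← T.space_eq]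
  exact T.complex.subset_space hs hx

theorem finite_faces : T.complex.faces.Finite := by
  classical
  refine (Finset.finite_toSet (Finset.univ.image fun v : P.Point => latt v.1).powerset).subset ?_
  intro s hs
  simp only [Finset.coe_powerset, Set.mem_preimage, Set.mem_powerset_iff, Finset.coe_subset]
  intro x hx
  obtain ⟨v, hv⟩ := T.exists_point_of_mem_face hs hx
  exact Finset.mem_image.2 ⟨v, Finset.mem_univ _, hv⟩

theorem exists_facet_of_face {s : Finset (Fin n → ℝ)} (hs : s ∈ T.complex.faces) :
    ∃ t ∈ T.complex.facets, s ⊆ t := by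
  obtain ⟨t, hst, ht⟩ := T.finite_faces.exists_le_maximal hs
  exact ⟨t, ⟨ht.1, fun u hu htu => le_antisymm htu (ht.2 hu htu)⟩, hst⟩

theorem exists_facet_of_mem {x : Fin n → ℝ} (hx : x ∈ P.carrier) :
    ∃ t ∈ T.complex.facets, x ∈ convexHull ℝ (t : Set (Fin n → ℝ)) := by
  rw [← T.space_eq, Geometry.SimplicialComplex.mem_space_iff] at hx
  obtain ⟨s, hs, hxs⟩ := hx
  obtain ⟨t, ht, hst⟩ := T.exists_facet_of_face hs
  exact ⟨t, ht, convexHull_mono (by exact_mod_cast hst) hxs⟩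

variable {T}

/-- Values at the vertices of a facet are interpolated by an affine function. -/
theorem exists_interpolation {s : Finset (Fin n → ℝ)} (hs : s ∈ T.complex.facets)
    (h : (Fin n → ℝ) → ℝ) : ∃ m : Fin n → ℝ, ∀ w ∈ s, m ⬝ᵥ w + h 0 = h w := by
  have h0 : (0 : Fin n → ℝ) ∈ s := T.zero_mem_facets s hs
  have hi := T.complex.indep hs.1
  -- With the vertex `0` as base point, the nonzero vertices are linearly independent, so a linear
  -- functional can be prescribed on them.
  rw [affineIndependent_iff_linearIndependent_vsub ℝ _ (⟨0, h0⟩ : s)] at hi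
  let f₀ := (Module.Basis.span hi).constr ℝ (fun i => h i.1.1 - h 0)
  obtain ⟨f, hf⟩ := f₀.exists_extend
  refine ⟨fun i => f (Pi.single i 1), fun w hw => ?_⟩
  have hfw : ∀ x : Fin n → ℝ, (fun i => f (Pi.single i 1)) ⬝ᵥ x = f x := by
    intro x
    conv_rhs => rw [pi_eq_sum_univ' x]
    simp [dotProduct, map_sum, mul_comm]
  rw [hfw]
  by_cases hw0 : w = 0
  · simp [hw0]
  · let i : {x : s // x ≠ ⟨0, h0⟩} := ⟨⟨w, hw⟩, fun h => hw0 (congrArg Subtype.val h)⟩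
    have h1 : f₀ ((Module.Basis.span hi) i) = h w - h 0 := by
      simp only [f₀, Module.Basis.constr_basis]
      rfl
    have h2 : (((Module.Basis.span hi) i : _) : Fin n → ℝ) = w := by
      rw [Module.Basis.span_apply]
      simp [i]
    have h3 : f w = h w - h 0 := by
      rw [← h1, ← hf, LinearMap.comp_apply, Submodule.subtype_apply, h2]
    rw [h3]
    ring

/-- Every lattice vector is an integral affine combination of the vertices of a facet. -/
theorem exists_coordinates {s : Finset (Fin n → ℝ)} (hs : s ∈ T.complex.facets)
    (v : Fin n → ℤ) : ∃ c : P.Point → ℤ, (∀ w, latt w.1 ∉ s → c w = 0) ∧ ∑ w, c w = 1 ∧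
      ∑ w, c w • w.1 = v := by
  classical
  have h1 := T.unimodular s hs v
  obtain ⟨f, hf, hfs⟩ := Submodule.mem_span_finset.1 h1
  have hinj : Set.InjOn (fun w : P.Point => latt w.1)
      ((Finset.univ.filter fun w : P.Point => latt w.1 ∈ s) : Set P.Point) :=
    fun a _ b _ h => Subtype.ext (latt_injective h)
  have himg : (Finset.univ.filter fun w : P.Point => latt w.1 ∈ s).image
      (fun w : P.Point => latt w.1) = s := by
    ext x
    simp only [Finset.mem_image, Finset.mem_filter, Finset.mem_univ, true_and]
    constructor
    · rintro ⟨w, hw, rfl⟩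
      exact hw
    · intro hx
      obtain ⟨w, rfl⟩ := T.exists_point_of_mem_face hs.1 hx
      exact ⟨w, hx, rfl⟩
  let c₀ : P.Point → ℤ := fun w => if latt w.1 ∈ s then f (latt w.1) else 0
  have hc₀ : ∑ w, c₀ w • w.1 = v := by
    apply latt_injective
    rw [← hfs, latt_sum, ← himg, Finset.sum_image hinj, Finset.sum_filter]
    refine Finset.sum_congr rfl fun w _ => ?_
    simp only [c₀]
    split_ifs with hw
    · rw [latt_zsmul, Int.cast_smul_eq_zsmul]
    · simp [latt_zero]
  -- The origin is a vertex of every facet and contributes the zero vector, so its coefficient is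
  -- free to make the total `1`.
  refine ⟨c₀ + Pi.single P.origin (1 - ∑ w, c₀ w), fun w hw => ?_, ?_, ?_⟩
  · have hw0 : w ≠ P.origin := by
      rintro rfl
      refine hw ?_
      rw [origin_val, latt_zero]
      exact T.zero_mem_facets s hs
    simp [c₀, hw, hw0]
  · simp [Finset.sum_add_distrib]
  · simp only [Pi.add_apply, add_smul, Finset.sum_add_distrib, hc₀]
    rw [Finset.sum_eq_zero, add_zero]
    intro w _
    by_cases hw : w = P.origin
    · simp [hw]
    · simp [hw]

open Classical in
/-- A facet `t` which contains a combination with small positive coefficients of the nonzero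
vertices of a facet `s` contains all vertices of `s`. -/
theorem subset_of_pos_combination {s t : Finset (Fin n → ℝ)} (hs : s ∈ T.complex.facets)
    (ht : t ∈ T.complex.facets) {α : P.Point → ℝ} (hα : ∀ w, 0 < α w) {x : Fin n → ℝ}
    (hx : x = ∑ w ∈ Finset.univ.filter (fun w : P.Point => latt w.1 ∈ s ∧ w ≠ P.origin),
      α w • latt w.1)
    (hα1 : ∑ w ∈ Finset.univ.filter (fun w : P.Point => latt w.1 ∈ s ∧ w ≠ P.origin), α w ≤ 1)
    (hxt : x ∈ convexHull ℝ (t : Set (Fin n → ℝ))) : s ⊆ t := by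
  set S : Finset P.Point := Finset.univ.filter fun w => latt w.1 ∈ s ∧ w ≠ P.origin with hS_def
  have hS : ∀ w ∈ S, latt w.1 ∈ s ∧ w ≠ P.origin := fun w hw => (Finset.mem_filter.1 hw).2
  have h0 : (0 : Fin n → ℝ) ∈ s := T.zero_mem_facets s hs
  have h0t : (0 : Fin n → ℝ) ∈ t := T.zero_mem_facets t ht
  have hxs : x ∈ convexHull ℝ (s : Set (Fin n → ℝ)) := by
    let o : Option S → ℝ := fun i => i.elim (1 - ∑ w ∈ S, α w) fun w => α w.1
    let y : Option S → Fin n → ℝ := fun i => i.elim 0 fun w => latt w.1.1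
    have h1 := (convex_convexHull ℝ (s : Set (Fin n → ℝ))).sum_mem (t := Finset.univ)
      (w := o) (z := y) ?_ ?_ ?_
    · convert h1 using 1
      rw [hx, Fintype.sum_option]
      simp only [o, y, Option.elim]
      rw [smul_zero, zero_add, ← Finset.sum_coe_sort S]
    · rintro (_ | w) _
      · exact sub_nonneg.2 hα1
      · exact (hα _).le
    · rw [Fintype.sum_option]
      simp only [o, Option.elim]
      rw [Finset.sum_coe_sort S fun w => α w]
      ring
    · rintro (_ | w) _
      · exact subset_convexHull ℝ _ h0
      · exact subset_convexHull ℝ _ (hS w.1 w.2).1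
  intro w₀ hw₀
  by_contra hw₀t
  have hw₀0 : w₀ ≠ 0 := fun h => hw₀t (h ▸ h0t)
  -- `m` reads off the coefficient of `w₀`. It vanishes on the hull of `s ∩ t`, which contains `x`,
  -- although that coefficient is positive.
  obtain ⟨m, hm⟩ := exists_interpolation hs fun w => if w = w₀ then 1 else 0
  simp only [hw₀0.symm, if_false, add_zero] at hm
  have hmx : m ⬝ᵥ x = 0 := by
    have h2 := T.complex.inter_subset_convexHull hs.1 ht.1 ⟨hxs, hxt⟩
    have h3 : convexHull ℝ ((s : Set (Fin n → ℝ)) ∩ t) ⊆ {x | m ⬝ᵥ x = 0} := by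
      refine convexHull_min ?_ ?_
      · rintro w ⟨hws, hwt⟩
        have hne : w ≠ w₀ := fun h => hw₀t (h ▸ hwt)
        exact (hm w hws).trans (if_neg hne)
      · intro x hx y hy p q _ _ _
        simp only [Set.mem_ofPred_eq] at hx hy ⊢
        rw [dotProduct_add, dotProduct_smul, dotProduct_smul, hx, hy, smul_zero, smul_zero,
          add_zero]
    exact h3 h2
  obtain ⟨v₀, rfl⟩ := T.exists_point_of_mem_face hs.1 hw₀
  have hv₀S : v₀ ∈ S := by
    refine Finset.mem_filter.2 ⟨Finset.mem_univ _, hw₀, fun h => hw₀0 ?_⟩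
    rw [h, origin_val, latt_zero]
  rw [hx, dotProduct_sum, Finset.sum_eq_single v₀] at hmx
  · rw [dotProduct_smul, hm _ hw₀, if_pos rfl, smul_eq_mul, mul_one] at hmx
    exact (hα v₀).ne' hmx
  · intro w hw hne
    rw [dotProduct_smul, hm _ (hS w hw).1, if_neg, smul_zero]
    exact fun h => hne (Subtype.ext (latt_injective h))
  · exact fun h => (h hv₀S).elim

/-- The affine function equal to `1` at the nonzero vertices of a facet and to `0` at the origin
is at most `1` on the polytope. -/
theorem dotProduct_le_one {s : Finset (Fin n → ℝ)} (hs : s ∈ T.complex.facets) {m : Fin n → ℝ}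
    (hm : ∀ w ∈ s, w ≠ 0 → m ⬝ᵥ w = 1) (v : P.Point) : m ⬝ᵥ latt v.1 ≤ 1 := by
  classical
  -- If `m ⬝ᵥ v > 1`, average the nonzero vertices of `s` and `v` with a small weight `τ` on `v`.
  -- The resulting point of the polytope is in the open cone over `s` but beyond the level `m = 1`;
  -- the facet containing it must be `s`, where `m ≤ 1`.
  by_contra! hlt
  have h0 : (0 : Fin n → ℝ) ∈ s := T.zero_mem_facets s hs
  obtain ⟨c, hcs, -, hcv⟩ := exists_coordinates hs v.1
  let S : Finset P.Point := Finset.univ.filter fun w => latt w.1 ∈ s ∧ w ≠ P.origin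
  have hS : ∀ w ∈ S, latt w.1 ∈ s ∧ w ≠ P.origin := fun w hw => (Finset.mem_filter.1 hw).2
  have hS0 : ∀ w ∈ S, latt w.1 ≠ 0 := fun w hw h =>
    (hS w hw).2 (Subtype.ext (latt_eq_zero.1 h))
  have hv : latt v.1 = ∑ w ∈ S, (c w : ℝ) • latt w.1 := by
    rw [← hcv, latt_sum]
    symm
    rw [Finset.sum_subset (Finset.subset_univ S)]
    · exact Finset.sum_congr rfl fun w _ => (latt_zsmul _ _).symm
    · intro w _ hw
      by_cases hw1 : latt w.1 ∈ s
      · have hw2 : w = P.origin := by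
          by_contra hw2
          exact hw (Finset.mem_filter.2 ⟨Finset.mem_univ _, hw1, hw2⟩)
        rw [hw2, origin_val, latt_zero, smul_zero]
      · rw [hcs w hw1, Int.cast_zero, zero_smul]
  have hmS : ∀ w ∈ S, m ⬝ᵥ latt w.1 = 1 := fun w hw => hm _ (hS w hw).1 (hS0 w hw)
  set τ : ℝ := (1 + ∑ w, |(c w : ℝ)|)⁻¹ with hτ
  have hden : 0 < 1 + ∑ w, |(c w : ℝ)| := by positivity
  have hτ0 : 0 < τ := inv_pos.2 hden
  have hpos : ∀ w, 0 < 1 + τ * c w := by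
    intro w
    have h1 : |(c w : ℝ)| < 1 + ∑ w, |(c w : ℝ)| := by
      have := Finset.single_le_sum (f := fun w => |(c w : ℝ)|) (fun _ _ => abs_nonneg _)
        (Finset.mem_univ w)
      linarith
    have h2 : τ * |(c w : ℝ)| < 1 := by
      rw [hτ, inv_mul_lt_iff₀ hden]
      linarith
    have h3 : -(τ * |(c w : ℝ)|) ≤ τ * c w := by
      rw [← mul_neg]
      exact mul_le_mul_of_nonneg_left (neg_abs_le _) hτ0.le
    linarith
  set z : Fin n → ℝ := ∑ w ∈ S, (1 + τ * (c w : ℝ)) • latt w.1 with hz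
  have hz' : z = (∑ w ∈ S, latt w.1) + τ • latt v.1 := by
    rw [hz, hv, Finset.smul_sum, ← Finset.sum_add_distrib]
    refine Finset.sum_congr rfl fun w _ => ?_
    rw [add_smul, one_smul, smul_smul]
  have hk : 0 < (S.card : ℝ) + τ := by positivity
  have hmz : m ⬝ᵥ z = S.card + τ * (m ⬝ᵥ latt v.1) := by
    rw [hz', dotProduct_add, dotProduct_sum, Finset.sum_congr rfl hmS, dotProduct_smul]
    simp
  have hmz' : m ⬝ᵥ z = ∑ w ∈ S, (1 + τ * (c w : ℝ)) := by
    rw [hz, dotProduct_sum]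
    refine Finset.sum_congr rfl fun w hw => ?_
    rw [dotProduct_smul, hmS w hw, smul_eq_mul, mul_one]
  have hzk : S.card + τ < m ⬝ᵥ z := by
    rw [hmz]
    nlinarith
  set y : Fin n → ℝ := ((S.card : ℝ) + τ)⁻¹ • z with hy
  have hyP : y ∈ P.carrier := by
    let o : Option S → ℝ := fun i => i.elim (((S.card : ℝ) + τ)⁻¹ * τ)
      fun _ => ((S.card : ℝ) + τ)⁻¹
    let x : Option S → Fin n → ℝ := fun i => i.elim (latt v.1) fun w => latt w.1.1
    have h1 := P.convex_carrier.sum_mem (t := Finset.univ) (w := o) (z := x) ?_ ?_ ?_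
    · convert h1 using 1
      rw [hy, hz', Fintype.sum_option]
      simp only [o, x, Option.elim]
      rw [smul_add, smul_smul, add_comm, ← Finset.smul_sum]
      congr 2
      exact (Finset.sum_coe_sort S fun w => latt w.1).symm
    · rintro (_ | w) _
      · exact mul_nonneg (inv_nonneg.2 hk.le) hτ0.le
      · exact inv_nonneg.2 hk.le
    · rw [Fintype.sum_option]
      simp only [o, Option.elim, Finset.sum_const, Finset.card_univ, Fintype.card_coe,
        nsmul_eq_mul]
      field_simp
      ring
    · rintro (_ | w) _
      · exact v.2
      · exact w.1.2
  have hmy : 1 < m ⬝ᵥ y := by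
    rw [hy, dotProduct_smul, smul_eq_mul, lt_inv_mul_iff₀ hk, mul_one]
    exact hzk
  obtain ⟨t, ht, hyt⟩ := T.exists_facet_of_mem hyP
  have h0t : (0 : Fin n → ℝ) ∈ t := T.zero_mem_facets t ht
  have hmz0 : 0 < m ⬝ᵥ z := hk.trans hzk
  -- Shrinking towards the common vertex `0` makes the coefficients of `z` sum to `1/2`, as
  -- `subset_of_pos_combination` needs.
  set ρ : ℝ := (2 * m ⬝ᵥ z)⁻¹ with hρ
  have hρ0 : 0 < ρ := by positivity
  have hρz : ρ * (m ⬝ᵥ z) = 1 / 2 := by rw [hρ]; field_simp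
  have hyt' : ρ • z ∈ convexHull ℝ (t : Set (Fin n → ℝ)) := by
    have h1 : ρ • z = (ρ * (S.card + τ)) • y := by
      rw [hy, smul_smul, mul_assoc, mul_inv_cancel₀ hk.ne', mul_one]
    rw [h1]
    have h2 : ρ * (S.card + τ) ≤ 1 := by
      have := mul_lt_mul_of_pos_left hzk hρ0
      linarith
    exact (convex_convexHull ℝ (t : Set (Fin n → ℝ))).smul_mem_of_zero_mem
      (subset_convexHull ℝ _ h0t) hyt ⟨(mul_pos hρ0 hk).le, h2⟩
  have hst : s ⊆ t := by
    refine subset_of_pos_combination hs ht (α := fun w => ρ * (1 + τ * c w))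
      (fun w => mul_pos hρ0 (hpos w)) ?_ ?_ hyt'
    · rw [hz, Finset.smul_sum]
      exact Finset.sum_congr rfl fun w _ => smul_smul _ _ _
    · rw [← Finset.mul_sum, ← hmz', hρz]
      norm_num
  have hst' : s = t := hs.2 ht.1 hst
  have h1 : convexHull ℝ (t : Set (Fin n → ℝ)) ⊆ {x | m ⬝ᵥ x ≤ 1} := by
    rw [← hst']
    refine convexHull_min ?_ ?_
    · intro w hw
      by_cases hw0 : w = 0
      · simp [hw0]
      · exact (hm w hw hw0).le
    · intro x₁ hx₁ x₂ hx₂ p q hp hq hpq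
      change m ⬝ᵥ (p • x₁ + q • x₂) ≤ 1
      rw [dotProduct_add, dotProduct_smul, dotProduct_smul, smul_eq_mul, smul_eq_mul, ← hpq]
      exact add_le_add (mul_le_of_le_one_right hp hx₁) (mul_le_of_le_one_right hq hx₂)
  exact absurd (h1 hyt) (not_le.2 hmy)

end RegularProjectiveTriangulation

end Facets

/-! ### Finitely generated pointed cones and their lattice points -/

section Cones

theorem exists_wordSum_eq_of_mem_closure {ι κ : Type*} (g : κ → ι → ℤ) {ℓ : ι → ℤ}
    (hℓ : ℓ ∈ AddSubmonoid.closure (Set.range g)) : ∃ σ, wordSum g σ = ℓ := by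
  obtain ⟨l, hl, rfl⟩ := AddSubmonoid.exists_list_of_mem_closure hℓ
  choose k hk using hl
  refine ⟨⟨l.length, fun i => k (l.get i) (l.get_mem i)⟩, ?_⟩
  rw [wordSum]
  simp only [hk]
  exact Fin.sum_univ_getElem l

variable {ι κ : Type*} [Fintype ι] [Fintype κ]

/-- Farkas' lemma for the cone generated by finitely many integral vectors in an open half
space. -/
theorem exists_nonneg_combination (r : κ → ι → ℤ) {ω₀ : ι → ℝ}
    (hω₀ : ∀ k, 0 < ∑ v, ω₀ v * (r k v : ℝ)) {x : ι → ℝ}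
    (hx : ∀ ω : ι → ℝ, (∀ k, 0 ≤ ∑ v, ω v * (r k v : ℝ)) → 0 ≤ ∑ v, ω v * x v) :
    ∃ t : κ → ℝ, (∀ k, 0 ≤ t k) ∧ ∀ v, x v = ∑ k, t k * (r k v : ℝ) := by
  classical
  let φ : (κ → ℝ) → ι → ℝ := fun t v => ∑ k, t k * (r k v : ℝ)
  have hφc : Continuous φ := by fun_prop
  let K : Set (ι → ℝ) := φ '' {t | ∀ k, 0 ≤ t k}
  suffices hxK : x ∈ K by
    obtain ⟨t, ht, rfl⟩ := hxK
    exact ⟨t, ht, fun v => rfl⟩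
  have hpair : ∀ (ω : ι → ℝ) t, ∑ v, ω v * φ t v = ∑ k, t k * ∑ v, ω v * (r k v : ℝ) := by
    intro ω t
    simp only [φ, Finset.mul_sum]
    rw [Finset.sum_comm]
    exact Finset.sum_congr rfl fun k _ => Finset.sum_congr rfl fun v _ => by ring
  -- Near a given point `ω₀` is bounded, which bounds every coefficient `t k`; locally the cone lies
  -- in the image of a compact box.
  have hclosed : IsClosed K := by
    refine isClosed_of_closure_subset fun y hy => ?_
    let O : Set (ι → ℝ) := {z | ∑ v, ω₀ v * z v < (∑ v, ω₀ v * y v) + 1}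
    have hO : IsOpen O := isOpen_lt (by fun_prop) continuous_const
    have hyO : y ∈ O := lt_add_one (∑ v, ω₀ v * y v)
    set B : ℝ := (∑ v, ω₀ v * y v) + 1
    let Q : Set (ι → ℝ) := φ '' Set.Icc 0 fun k => B / ∑ v, ω₀ v * (r k v : ℝ)
    have hQ : IsClosed Q := (isCompact_Icc.image hφc).isClosed
    have hsub : O ∩ K ⊆ Q := by
      rintro _ ⟨hz, t, ht, rfl⟩
      refine ⟨t, ⟨ht, fun k => ?_⟩, rfl⟩
      rw [le_div_iff₀ (hω₀ k)]
      have h1 : ∑ k, t k * ∑ v, ω₀ v * (r k v : ℝ) < B := by rw [← hpair]; exact hz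
      have h2 := Finset.single_le_sum (f := fun k => t k * ∑ v, ω₀ v * (r k v : ℝ))
        (fun k _ => mul_nonneg (ht k) (hω₀ k).le) (Finset.mem_univ k)
      exact h2.trans h1.le
    have hyQ : y ∈ Q := closure_minimal hsub hQ (hO.inter_closure ⟨hyO, hy⟩)
    obtain ⟨t, ht, rfl⟩ := hyQ
    exact ⟨t, fun k => ht.1 k, rfl⟩
  have hconv : Convex ℝ K := by
    rintro _ ⟨t, ht, rfl⟩ _ ⟨u, hu, rfl⟩ p q hp hq _
    refine ⟨p • t + q • u, fun k => ?_, ?_⟩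
    · exact add_nonneg (mul_nonneg hp (ht k)) (mul_nonneg hq (hu k))
    · funext v
      simp only [φ, Pi.add_apply, Pi.smul_apply, smul_eq_mul, Finset.mul_sum,
        ← Finset.sum_add_distrib]
      exact Finset.sum_congr rfl fun k _ => by ring
  by_contra hxK
  obtain ⟨f, u, hfx, hfK⟩ := geometric_hahn_banach_point_closed hconv hclosed hxK
  have hu : u < 0 := by
    have := hfK 0 ⟨0, fun _ => le_rfl, by funext v; simp [φ]⟩
    simpa using this
  have hf : ∀ y : ι → ℝ, f y = ∑ v, f (Pi.single v 1) * y v := by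
    intro y
    conv_lhs => rw [pi_eq_sum_univ' y]
    simp [map_sum, mul_comm]
  have hneg := hx (fun v => f (Pi.single v 1)) fun k => by
    by_contra! hk
    -- This positive multiple of `r k` has `f`-value exactly `u`, against the strict separation.
    have h1 := hfK (φ (Pi.single k (u / ∑ v, f (Pi.single v 1) * (r k v : ℝ))))
      ⟨_, fun j => by
        by_cases hj : j = k
        · subst hj
          rw [Pi.single_eq_same]
          exact (div_pos_of_neg_of_neg hu hk).le
        · rw [Pi.single_eq_of_ne hj], rfl⟩
    rw [hf, hpair, Finset.sum_eq_single k] at h1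
    · rw [Pi.single_eq_same, div_mul_cancel₀ _ hk.ne] at h1
      exact lt_irrefl _ h1
    · intro j _ hj
      rw [Pi.single_eq_of_ne hj, zero_mul]
    · simp
  rw [← hf] at hneg
  linarith

/-- Gordan's lemma: the lattice points of a pointed rational cone form a finitely generated
monoid. -/
theorem exists_finite_generators (r : κ → ι → ℤ) {ω₀ : ι → ℝ}
    (hω₀ : ∀ k, 0 < ∑ v, ω₀ v * (r k v : ℝ)) (L : AddSubgroup (ι → ℤ)) (hr : ∀ k, r k ∈ L)
    (M : Set (ι → ℤ)) (hM : ∀ ℓ, ℓ ∈ M ↔ ℓ ∈ L ∧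
      ∀ ω : ι → ℝ, (∀ k, 0 ≤ ∑ v, ω v * (r k v : ℝ)) → 0 ≤ ∑ v, ω v * (ℓ v : ℝ)) :
    ∃ G : Set (ι → ℤ), G.Finite ∧ (∀ ℓ ∈ G, ℓ ∈ M ∧ 0 < ∑ v, ω₀ v * (ℓ v : ℝ)) ∧
      ∀ ℓ ∈ M, ℓ ∈ AddSubmonoid.closure G := by
  classical
  have hpair : ∀ (ω : ι → ℝ) (t : κ → ℝ),
      ∑ v, ω v * ∑ k, t k * (r k v : ℝ) = ∑ k, t k * ∑ v, ω v * (r k v : ℝ) := by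
    intro ω t
    simp only [Finset.mul_sum]
    rw [Finset.sum_comm]
    exact Finset.sum_congr rfl fun k _ => Finset.sum_congr rfl fun v _ => by ring
  let B : Set (ι → ℤ) := {b | b ∈ M ∧ ∃ t : κ → ℝ, (∀ k, 0 ≤ t k ∧ t k ≤ 1) ∧
    ∀ v, (b v : ℝ) = ∑ k, t k * (r k v : ℝ)}
  have hB : B.Finite := by
    refine (Set.finite_Icc (fun v => -∑ k, |r k v|) (fun v => ∑ k, |r k v|)).subset ?_
    rintro b ⟨-, t, ht, hb⟩
    have h1 : ∀ v, |b v| ≤ ∑ k, |r k v| := by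
      intro v
      have h2 : |(b v : ℝ)| ≤ ∑ k, |(r k v : ℝ)| := by
        rw [hb v]
        refine (Finset.abs_sum_le_sum_abs _ _).trans (Finset.sum_le_sum fun k _ => ?_)
        rw [abs_mul, abs_of_nonneg (ht k).1]
        exact mul_le_of_le_one_left (abs_nonneg _) (ht k).2
      exact_mod_cast h2
    exact ⟨fun v => (abs_le.1 (h1 v)).1, fun v => (abs_le.1 (h1 v)).2⟩
  have hrM : ∀ k, r k ∈ M := fun k => (hM _).2 ⟨hr k, fun ω hω => hω k⟩
  have hpos : ∀ ℓ ∈ M, ℓ ≠ 0 → 0 < ∑ v, ω₀ v * (ℓ v : ℝ) := by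
    intro ℓ hℓ hne
    obtain ⟨t, ht, hℓt⟩ := exists_nonneg_combination r hω₀ ((hM ℓ).1 hℓ).2
    simp only [hℓt, hpair]
    refine Finset.sum_pos' (fun k _ => mul_nonneg (ht k) (hω₀ k).le) ?_
    by_contra! h
    refine hne (funext fun v => ?_)
    have h1 : ∀ k, t k = 0 := fun k => by
      have h2 := h k (Finset.mem_univ k)
      refine le_antisymm ?_ (ht k)
      by_contra! h3
      exact absurd (mul_pos h3 (hω₀ k)) (not_lt.2 h2)
    have h2 := hℓt v
    simp only [h1, zero_mul, Finset.sum_const_zero] at h2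
    exact_mod_cast h2
  refine ⟨B \ {0}, hB.subset Set.sdiff_subset, fun ℓ hℓ => ⟨hℓ.1.1, hpos ℓ hℓ.1.1 hℓ.2⟩, ?_⟩
  intro ℓ hℓ
  obtain ⟨t, ht, hℓt⟩ := exists_nonneg_combination r hω₀ ((hM ℓ).1 hℓ).2
  have hrB : ∀ k, r k ∈ B \ {0} := by
    intro k
    refine ⟨⟨hrM k, Pi.single k 1, fun j => ?_, fun v => ?_⟩, ?_⟩
    · by_cases hj : j = k
      · subst hj; simp
      · simp [hj]
    · simp [Pi.single_apply]
    · intro h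
      have h1 := hω₀ k
      rw [Set.mem_singleton_iff.1 h] at h1
      simp at h1
  -- The fractional parts leave a lattice point of the bounded set `B`, which also contains every `r
  -- k`.
  have hdecomp : ℓ = ∑ k, ⌊t k⌋₊ • r k + (ℓ - ∑ k, ⌊t k⌋₊ • r k) := by abel
  have hcast : ∀ v, (((ℓ - ∑ k, ⌊t k⌋₊ • r k) v : ℤ) : ℝ) =
      ∑ k, (t k - ⌊t k⌋₊) * (r k v : ℝ) := by
    intro v
    simp only [Pi.sub_apply, Finset.sum_apply, nsmul_eq_mul,
      Pi.mul_apply, Pi.natCast_apply]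
    push_cast
    rw [hℓt v, ← Finset.sum_sub_distrib]
    exact Finset.sum_congr rfl fun k _ => by ring
  have hfr : ∀ k, 0 ≤ t k - ⌊t k⌋₊ ∧ t k - ⌊t k⌋₊ ≤ 1 := fun k =>
    ⟨sub_nonneg.2 (Nat.floor_le (ht k)), by have := Nat.lt_floor_add_one (t k); linarith⟩
  have hb : ℓ - ∑ k, ⌊t k⌋₊ • r k ∈ B := by
    refine ⟨(hM _).2 ⟨?_, fun ω hω => ?_⟩, fun k => t k - ⌊t k⌋₊, hfr, hcast⟩
    · exact L.sub_mem ((hM ℓ).1 hℓ).1 (L.sum_mem fun k _ => L.nsmul_mem (hr k) _)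
    · simp only [hcast, hpair]
      exact Finset.sum_nonneg fun k _ => mul_nonneg (hfr k).1 (hω k)
  rw [hdecomp]
  refine AddSubmonoid.add_mem _ (AddSubmonoid.sum_mem _ fun k _ =>
    AddSubmonoid.nsmul_mem _ (AddSubmonoid.subset_closure (hrB k)) _) ?_
  by_cases h0 : ℓ - ∑ k, ⌊t k⌋₊ • r k = 0
  · rw [h0]
    exact AddSubmonoid.zero_mem _
  · exact AddSubmonoid.subset_closure ⟨hb, h0⟩

end Cones

/-! ### The Mori cone -/

section Mori

variable {n : ℕ} {P : ReflexivePolytope n}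

/-- The degree `(∑ p_v v, ∑ p_v)` of an exponent. -/
def expDegree (P : ReflexivePolytope n) : (P.Point → ℤ) →+ (Fin n → ℤ) × ℤ where
  toFun p := (∑ v, p v • v.1, ∑ v, p v)
  map_zero' := by simp
  map_add' p q := by simp [add_smul, Finset.sum_add_distrib]

theorem mem_relations_iff {ℓ : P.Point → ℤ} : ℓ ∈ P.relations ↔ expDegree P ℓ = 0 := by
  rw [Prod.ext_iff]
  rfl

theorem sum_affine_mul_of_mem_relations {ℓ : P.Point → ℤ} (hℓ : ℓ ∈ P.relations)
    (m : Fin n → ℝ) (c : ℝ) : ∑ v : P.Point, (m ⬝ᵥ latt v.1 + c) * (ℓ v : ℝ) = 0 := by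
  have h1 : ∑ v : P.Point, (ℓ v : ℝ) • latt v.1 = 0 := by
    simp only [← latt_zsmul]
    rw [← latt_sum, hℓ.1, latt_zero]
  have h2 : ∑ v : P.Point, (ℓ v : ℝ) = 0 := by exact_mod_cast hℓ.2
  calc ∑ v : P.Point, (m ⬝ᵥ latt v.1 + c) * (ℓ v : ℝ)
      = m ⬝ᵥ (∑ v : P.Point, (ℓ v : ℝ) • latt v.1) + c * ∑ v : P.Point, (ℓ v : ℝ) := by
        rw [dotProduct_sum, Finset.mul_sum, ← Finset.sum_add_distrib]
        refine Finset.sum_congr rfl fun v _ => ?_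
        rw [dotProduct_smul, smul_eq_mul]
        ring
    _ = 0 := by rw [h1, h2, dotProduct_zero, mul_zero, add_zero]

variable {T : RegularProjectiveTriangulation P.carrier}

/-- The relation expressing a lattice point by the vertices of a facet. -/
theorem exists_facet_relation {s : Finset (Fin n → ℝ)} (hs : s ∈ T.complex.facets)
    (v : P.Point) : ∃ r ∈ P.relations, (latt v.1 ∈ s → r = 0) ∧
      ∀ (ω : P.Point → ℝ) (m : Fin n → ℝ) (c : ℝ),
        (∀ w : P.Point, latt w.1 ∈ s → m ⬝ᵥ latt w.1 + c = ω w) →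
          ∑ w, ω w * (r w : ℝ) = ω v - (m ⬝ᵥ latt v.1 + c) := by
  classical
  by_cases hv : latt v.1 ∈ s
  · refine ⟨0, by simp [mem_relations_iff], fun _ => rfl, fun ω m c h => ?_⟩
    rw [h v hv]
    simp
  obtain ⟨c₀, hc₀, hsum, hcv⟩ :=
    RegularProjectiveTriangulation.exists_coordinates hs v.1
  have hrel : Pi.single v 1 - c₀ ∈ P.relations := by
    refine ⟨?_, ?_⟩
    · simp only [Pi.sub_apply, sub_smul, Finset.sum_sub_distrib, hcv]
      rw [Finset.sum_eq_single v]
      · simp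
      · intro w _ hw
        simp [hw]
      · simp
    · simp [Finset.sum_sub_distrib, hsum]
  refine ⟨_, hrel, fun h => (hv h).elim, fun ω m c h => ?_⟩
  -- Relations annihilate affine functions. After subtracting the one that agrees with `ω` on `s`,
  -- only the term at `v` survives.
  have h1 := sum_affine_mul_of_mem_relations hrel m c
  rw [← sub_zero (∑ w, ω w * _), ← h1, ← Finset.sum_sub_distrib, Finset.sum_eq_single v]
  · simp only [Pi.sub_apply, Pi.single_eq_same, hc₀ v hv]
    push_cast
    ring
  · intro w _ hw
    by_cases hws : latt w.1 ∈ s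
    · rw [h w hws]
      ring
    · simp [hw, hc₀ w hws]
  · simp

theorem kaehlerCone_interpolation {s : Finset (Fin n → ℝ)} (hs : s ∈ T.complex.facets)
    (ω : P.Point → ℝ) : ∃ (m : Fin n → ℝ) (c : ℝ),
      ∀ w : P.Point, latt w.1 ∈ s → m ⬝ᵥ latt w.1 + c = ω w := by
  classical
  obtain ⟨m, hm⟩ := RegularProjectiveTriangulation.exists_interpolation hs
    (Function.extend (fun w : P.Point => latt w.1) ω 0)
  have hinj : Function.Injective fun w : P.Point => latt w.1 := fun a b h =>
    Subtype.ext (latt_injective h)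
  refine ⟨m, _, fun w hw => (hm _ hw).trans ?_⟩
  exact hinj.extend_apply ω 0 w

variable (T)

/-- The Kähler cone is cut out by finitely many integral relations, which are positive on some
weight. -/
theorem exists_kaehlerCone_relations : ∃ (κ : Type) (_ : Fintype κ) (r : κ → P.Point → ℤ),
    (∀ k, r k ∈ P.relations) ∧
    (∀ ω, ω ∈ kaehlerCone T ↔ ∀ k, 0 ≤ ∑ v, ω v * (r k v : ℝ)) ∧
    ∃ ω₀ : P.Point → ℝ, ∀ k, 0 < ∑ v, ω₀ v * (r k v : ℝ) := by
  classical
  have hfin : T.complex.facets.Finite := T.finite_faces.subset fun s hs => hs.1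
  have : Finite T.complex.facets := hfin
  choose r hrL hr0 hr using fun k : T.complex.facets × P.Point =>
    exists_facet_relation k.1.2 k.2
  -- Vertices of the facet give the zero relation, which must be dropped for strict positivity of
  -- the weight.
  refine ⟨{k : T.complex.facets × P.Point // r k ≠ 0}, Fintype.ofFinite _, fun k => r k.1,
    fun k => hrL k.1, fun ω => ⟨fun hω k => ?_, fun hω s hs => ?_⟩, ?_⟩
  · obtain ⟨m, c, h1, h2⟩ := hω k.1.1.1 k.1.1.2
    rw [hr k.1 ω m c h1]
    exact sub_nonneg.2 (h2 _)
  · obtain ⟨m, c, h1⟩ := kaehlerCone_interpolation hs ω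
    refine ⟨m, c, h1, fun v => ?_⟩
    have h2 := hr (⟨s, hs⟩, v) ω m c h1
    have h3 : 0 ≤ ∑ w, ω w * (r (⟨s, hs⟩, v) w : ℝ) := by
      by_cases h : r (⟨s, hs⟩, v) = 0
      · simp [h]
      · exact hω ⟨_, h⟩
    linarith
  · obtain ⟨ω, hω⟩ := T.projective
    refine ⟨fun v => ω v.1, fun k => ?_⟩
    obtain ⟨m, c, h1, h2⟩ := hω k.1.1.1 k.1.1.2
    rw [hr k.1 (fun v => ω v.1) m c fun w hw => h1 _ hw]
    exact sub_pos.2 (h2 _ k.1.2.2 fun h => k.2 (hr0 _ h))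

/-- The Mori points are finitely generated, by vectors on which some weight is positive. -/
theorem exists_mori_generators : ∃ (κ : Type) (_ : Fintype κ) (g : κ → P.Point → ℤ),
    (∀ k, g k ∈ moriPoints T ∧ g k ≠ 0) ∧ (∀ ℓ ∈ moriPoints T, ∃ σ, wordSum g σ = ℓ) ∧
    ∃ ω₀ : P.Point → ℝ, ∀ k, 0 < ∑ v, ω₀ v * (g k v : ℝ) := by
  classical
  obtain ⟨κ, _, r, hrL, hr, ω₀, hω₀⟩ := exists_kaehlerCone_relations T
  obtain ⟨G, hG, hGM, hgen⟩ := exists_finite_generators r hω₀ (expDegree P).ker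
    (fun k => mem_relations_iff.1 (hrL k)) (moriPoints T) fun ℓ => by
      simp only [moriPoints, Set.mem_ofPred_eq, mem_relations_iff, hr]
      rfl
  have : Finite G := hG
  refine ⟨G, Fintype.ofFinite _, fun k => k.1, fun k => ⟨(hGM k k.2).1, fun h => ?_⟩,
    fun ℓ hℓ => ?_, ω₀, fun k => (hGM k k.2).2⟩
  · have := (hGM k k.2).2
    simp only at h
    rw [h] at this
    simp at this
  · have : Fintype G := Fintype.ofFinite _
    refine exists_wordSum_eq_of_mem_closure _ ?_
    rw [Subtype.range_coe]
    exact hgen ℓ hℓ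

variable {T}

/-- For `ε ≤ 1` a nonempty product of numbers below `ε` is again below `ε`, so finitely many
generators control all of `M`. -/
theorem nearLCSL_eq_smallRegion {κ : Type} {g : κ → P.Point → ℤ}
    (hg : ∀ k, g k ∈ moriPoints T ∧ g k ≠ 0) (hgen : ∀ ℓ ∈ moriPoints T, ∃ σ, wordSum g σ = ℓ)
    {ε : ℝ} (hε : ε ≤ 1) : nearLCSL T ε = smallRegion g ε := by
  ext a
  refine ⟨fun ha => ⟨ha.1, fun k => ha.2 _ (hg k).1 (hg k).2⟩, fun ha => ⟨ha.1, ?_⟩⟩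
  intro ℓ hℓ hne
  obtain ⟨⟨N, σ⟩, rfl⟩ := hgen ℓ hℓ
  change ‖laurent a _‖ < ε
  rw [laurent_wordSum ha.1]
  cases N with
  | zero => exact (hne (by simp [wordSum])).elim
  | succ N =>
    simp only
    rw [Fin.prod_univ_succ, norm_mul]
    refine lt_of_le_of_lt (mul_le_of_le_one_right (norm_nonneg _) ?_) (ha.2 (σ 0))
    rw [norm_prod]
    exact Finset.prod_le_one (fun _ _ => norm_nonneg _) fun k _ => (ha.2 _).le.trans hε

/-- The point with coordinates `exp(-c ω₀ v)` works for large `c`. -/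
theorem smallRegion_nonempty {ι κ : Type*} [Fintype ι] [Finite κ] {g : κ → ι → ℤ} {ω₀ : ι → ℝ}
    (hω₀ : ∀ k, 0 < ∑ v, ω₀ v * (g k v : ℝ)) {ε : ℝ} (hε : 0 < ε) :
    (smallRegion g ε).Nonempty := by
  have h : ∀ᶠ c : ℝ in Filter.atTop, ∀ k, Real.exp (-(c * ∑ v, ω₀ v * (g k v : ℝ))) < ε := by
    refine Filter.eventually_all.2 fun k => ?_
    have h1 : Filter.Tendsto (fun c : ℝ => Real.exp (-(c * ∑ v, ω₀ v * (g k v : ℝ))))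
        Filter.atTop (nhds 0) :=
      Real.tendsto_exp_neg_atTop_nhds_zero.comp (Filter.tendsto_id.atTop_mul_const (hω₀ k))
    exact h1.eventually_lt_const hε
  obtain ⟨c, hc⟩ := h.exists
  refine ⟨fun v => Complex.exp ((-(c * ω₀ v) : ℝ) : ℂ), fun v => Complex.exp_ne_zero _,
    fun k => lt_of_eq_of_lt ?_ (hc k)⟩
  rw [laurent, norm_prod, Finset.mul_sum, ← Finset.sum_neg_distrib, Real.exp_sum]
  refine Finset.prod_congr rfl fun v _ => ?_
  rw [norm_zpow, Complex.norm_exp, Complex.ofReal_re, ← Real.rpow_intCast, ← Real.exp_mul]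
  congr 1
  ring

/-- A convex weight minus its affine function on `s` vanishes on `s` and is nonnegative elsewhere,
while subtracting it does not change the pairing with a relation. -/
theorem mem_moriPoints_of_nonneg_off_facet {s : Finset (Fin n → ℝ)} (hs : s ∈ T.complex.facets)
    {ℓ : P.Point → ℤ} (hℓ : ℓ ∈ P.relations) (hpos : ∀ v, latt v.1 ∉ s → 0 ≤ ℓ v) :
    ℓ ∈ moriPoints T := by
  refine ⟨hℓ, fun ω hω => ?_⟩
  obtain ⟨m, c, h1, h2⟩ := hω s hs
  have h3 : ∑ v, ω v * (ℓ v : ℝ) =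
      ∑ v, (ω v * (ℓ v : ℝ) - (m ⬝ᵥ latt v.1 + c) * (ℓ v : ℝ)) := by
    rw [Finset.sum_sub_distrib, sum_affine_mul_of_mem_relations hℓ m c, sub_zero]
  rw [h3]
  refine Finset.sum_nonneg fun v _ => ?_
  rw [← sub_mul]
  by_cases hv : latt v.1 ∈ s
  · rw [h1 v hv, sub_self, zero_mul]
  · exact mul_nonneg (sub_nonneg.2 (h2 v)) (Int.cast_nonneg (hpos v hv))

/-- The weight `-1` at the origin and `0` elsewhere is convex by `dotProduct_le_one`; pair it with
`ℓ`. -/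
theorem moriPoints_origin_nonpos {ℓ : P.Point → ℤ} (hℓ : ℓ ∈ moriPoints T) :
    ℓ P.origin ≤ 0 := by
  classical
  have hω : (fun v : P.Point => if v = P.origin then (-1 : ℝ) else 0) ∈ kaehlerCone T := by
    intro s hs
    obtain ⟨m, hm⟩ := RegularProjectiveTriangulation.exists_interpolation hs
      fun w => if w = 0 then (-1 : ℝ) else 0
    simp only [if_true] at hm
    have hne : ∀ v : P.Point, v ≠ P.origin → latt v.1 ≠ 0 := fun v hv h =>
      hv (Subtype.ext (latt_eq_zero.1 h))
    refine ⟨m, -1, fun v hv => ?_, fun v => ?_⟩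
    · rw [hm _ hv]
      by_cases hv0 : v = P.origin
      · simp [hv0]
      · simp only [if_neg (hne v hv0), if_neg hv0]
    · by_cases hv0 : v = P.origin
      · simp [hv0, latt_zero]
      · simp only [if_neg hv0]
        have h1 := RegularProjectiveTriangulation.dotProduct_le_one hs (m := m)
          (fun w hw hw0 => by
            have := hm w hw
            rw [if_neg hw0] at this
            linarith) v
        linarith
  have h1 := hℓ.2 _ hω
  simp only [ite_mul, zero_mul, Finset.sum_ite_eq', Finset.mem_univ, if_true] at h1
  have h2 : (ℓ P.origin : ℝ) ≤ 0 := by linarith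
  exact_mod_cast h2

end Mori

/-! ### The cohomology ring -/

section Cohomology

variable {n : ℕ} {P : ReflexivePolytope n} (T : RegularProjectiveTriangulation P.carrier)

/-- The quotient map from the polynomial ring. -/
def toCohomology : MvPolynomial P.Point ℂ →ₐ[ℂ] CohomologyRing T :=
  Ideal.Quotient.mkₐ ℂ (cohomologyIdeal T)

theorem toCohomology_surjective : Function.Surjective (toCohomology T) :=
  Ideal.Quotient.mkₐ_surjective ℂ (cohomologyIdeal T)

theorem toCohomology_eq_zero {q : MvPolynomial P.Point ℂ} (hq : q ∈ cohomologyIdeal T) :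
    toCohomology T q = 0 :=
  Ideal.Quotient.eq_zero_iff_mem.2 hq

theorem sum_divisor : ∑ v, divisor T v = 0 := by
  have h := toCohomology_eq_zero T (q := ∑ v : P.Point, MvPolynomial.X v)
    (Ideal.subset_span (Or.inl (Or.inl rfl)))
  rwa [map_sum] at h

theorem toCohomology_X (v : P.Point) : toCohomology T (MvPolynomial.X v) = divisor T v := rfl

theorem sum_coord_smul_divisor (j : Fin n) : ∑ v : P.Point, ((v.1 j : ℤ) : ℂ) • divisor T v = 0 := by
  have h := toCohomology_eq_zero T (Ideal.subset_span (Or.inl (Or.inr ⟨j, rfl⟩)))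
  rw [map_sum] at h
  simpa only [← MvPolynomial.smul_eq_C_mul, map_smul, toCohomology_X] using h

theorem sum_dotProduct_smul_divisor (m : Fin n → ℝ) :
    ∑ v : P.Point, ((m ⬝ᵥ latt v.1 : ℝ) : ℂ) • divisor T v = 0 := by
  have h : ∀ v : P.Point, ((m ⬝ᵥ latt v.1 : ℝ) : ℂ) • divisor T v =
      ∑ j, (m j : ℂ) • (((v.1 j : ℤ) : ℂ) • divisor T v) := by
    intro v
    rw [dotProduct, Complex.ofReal_sum, Finset.sum_smul]
    refine Finset.sum_congr rfl fun j _ => ?_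
    rw [smul_smul]
    simp [latt]
  simp only [h]
  rw [Finset.sum_comm]
  simp only [← Finset.smul_sum, sum_coord_smul_divisor, smul_zero, Finset.sum_const_zero]

/-- The Stanley–Reisner relations. -/
theorem exists_facet_of_prod_divisor_ne_zero {S : Finset P.Point} (h0 : P.origin ∉ S)
    (hS : ∏ v ∈ S, divisor T v ≠ 0) : ∃ t ∈ T.complex.facets, ∀ v ∈ S, latt v.1 ∈ t := by
  rcases S.eq_empty_or_nonempty with rfl | hne
  · obtain ⟨t, ht, -⟩ := T.exists_facet_of_mem P.origin.2
    exact ⟨t, ht, by simp⟩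
  have h1 : ∃ s ∈ T.complex.faces,
      (s : Set (Fin n → ℝ)) = (fun v : P.Point => latt v.1) '' (S : Set P.Point) := by
    by_contra! h
    refine hS ?_
    have h2 := toCohomology_eq_zero T (Ideal.subset_span (Or.inr ⟨S, hne, h0, h, rfl⟩))
    rwa [map_prod] at h2
  obtain ⟨s, hs, hsS⟩ := h1
  obtain ⟨t, ht, hst⟩ := T.exists_facet_of_face hs
  refine ⟨t, ht, fun v hv => hst ?_⟩
  have : latt v.1 ∈ (s : Set (Fin n → ℝ)) := by
    rw [hsS]
    exact ⟨v, hv, rfl⟩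
  exact this

/-- Modulo a prime `J`, the nonzero points whose classes are not in `J` have nonzero product, so
they lie in one facet. The functional equal to `1` at one of them and `0` at the other vertices
gives a linear relation placing its class in `J`. Finally `D_0` is minus the sum of the others. -/
theorem isNilpotent_divisor (v : P.Point) : IsNilpotent (divisor T v) := by
  classical
  rw [nilpotent_iff_mem_prime]
  intro J hJ
  have key : ∀ v, v ≠ P.origin → divisor T v ∈ J := by
    intro v hv0
    by_contra hv
    let S : Finset P.Point := Finset.univ.filter fun w => w ≠ P.origin ∧ divisor T w ∉ J
    have hprod : ∏ w ∈ S, divisor T w ≠ 0 := by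
      intro h
      have h1 : ∏ w ∈ S, divisor T w ∈ J := by rw [h]; exact J.zero_mem
      obtain ⟨w, hw, hwJ⟩ := hJ.prod_mem_iff.1 h1
      exact (Finset.mem_filter.1 hw).2.2 hwJ
    obtain ⟨t, ht, hSt⟩ := exists_facet_of_prod_divisor_ne_zero T (by simp [S]) hprod
    have hne : ∀ w : P.Point, w ≠ P.origin → latt w.1 ≠ 0 := fun w hw h =>
      hw (Subtype.ext (latt_eq_zero.1 h))
    obtain ⟨m, hm⟩ := RegularProjectiveTriangulation.exists_interpolation ht
      fun w => if w = latt v.1 then 1 else 0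
    simp only [(hne v hv0).symm, if_false, add_zero] at hm
    have hvS : v ∈ S := Finset.mem_filter.2 ⟨Finset.mem_univ _, hv0, hv⟩
    have h1 := sum_dotProduct_smul_divisor T m
    rw [← Finset.add_sum_erase _ _ (Finset.mem_univ v), hm _ (hSt v hvS), if_pos rfl,
      Complex.ofReal_one, one_smul] at h1
    refine hv ?_
    rw [eq_neg_of_add_eq_zero_left h1]
    refine J.neg_mem (J.sum_mem fun w hw => ?_)
    by_cases hw0 : w = P.origin
    · rw [hw0, origin_val, latt_zero, dotProduct_zero, Complex.ofReal_zero, zero_smul]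
      exact J.zero_mem
    by_cases hwJ : divisor T w ∈ J
    · rw [Algebra.smul_def]
      exact J.mul_mem_left _ hwJ
    · have hwS : w ∈ S := Finset.mem_filter.2 ⟨Finset.mem_univ _, hw0, hwJ⟩
      rw [hm _ (hSt w hwS), if_neg, Complex.ofReal_zero, zero_smul]
      · exact J.zero_mem
      · exact fun h => Finset.ne_of_mem_erase hw (Subtype.ext (latt_injective h))
  by_cases hv0 : v = P.origin
  · have h1 := sum_divisor T
    rw [← Finset.add_sum_erase _ _ (Finset.mem_univ P.origin)] at h1
    rw [hv0, eq_neg_of_add_eq_zero_left h1]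
    exact J.neg_mem (J.sum_mem fun w hw => key w (Finset.ne_of_mem_erase hw))
  · exact key v hv0

theorem finite_cohomologyRing : Module.Finite ℂ (CohomologyRing T) := by
  have hadj : Algebra.adjoin ℂ (Set.range (divisor T)) = ⊤ := by
    have h1 : Set.range (divisor T) = toCohomology T '' Set.range MvPolynomial.X := by
      rw [← Set.range_comp]
      rfl
    rw [h1, ← AlgHom.map_adjoin, MvPolynomial.adjoin_range_X, Algebra.map_top]
    exact (AlgHom.range_eq_top _).2 (toCohomology_surjective T)
  have hfg := fg_adjoin_of_finite (R := ℂ) (Set.finite_range (divisor T)) (by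
    rintro _ ⟨v, rfl⟩
    obtain ⟨N, hN⟩ := isNilpotent_divisor T v
    refine IsIntegral.of_pow (Nat.succ_pos N) ?_
    rw [pow_succ, hN, zero_mul]
    exact isIntegral_zero)
  rw [hadj] at hfg
  exact ⟨by simpa using hfg⟩

variable {T}

/-- For `p v < 0` the numerator contains the factor `D v - 0`. -/
theorem prod_dvd_gammaCoeff {R : Type*} [CommRing R] {ι : Type*} [Fintype ι] (D : ι → R)
    (p : ι → ℤ) {S : Finset ι} (hS : ∀ v ∈ S, p v < 0) :
    ∏ v ∈ S, D v ∣ gammaCoeff D p := by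
  classical
  refine (Finset.prod_dvd_prod_of_dvd _ (fun v => gammaFactor (D v) (p v)) fun v hv => ?_).trans
    (Finset.prod_dvd_prod_of_subset _ _ _ (Finset.subset_univ S))
  have h := hS v hv
  obtain ⟨N, hN⟩ : ∃ N, (-p v).toNat = N + 1 := ⟨(-p v).toNat - 1, by omega⟩
  rw [gammaFactor, hN, Finset.prod_range_succ']
  simp only [Nat.cast_zero, sub_zero]
  exact Dvd.dvd.mul_right (Dvd.intro_left _ rfl) _

/-- The gamma coefficients are supported on translates of the Mori cone. -/
theorem add_mem_moriPoints_of_gammaCoeff_ne_zero {p : P.Point → ℤ} {m : P.Point → ℕ}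
    (hp : gammaCoeff (divisor T) p ≠ 0) (hrel : (p + fun v => (m v : ℤ)) ∈ P.relations) :
    (p + fun v => (m v : ℤ)) ∈ moriPoints T := by
  classical
  let S : Finset P.Point := Finset.univ.filter fun v => v ≠ P.origin ∧ p v < 0
  have hS : ∏ v ∈ S, divisor T v ≠ 0 := by
    intro h
    refine hp (zero_dvd_iff.1 ?_)
    rw [← h]
    exact prod_dvd_gammaCoeff _ _ fun v hv => (Finset.mem_filter.1 hv).2.2
  obtain ⟨t, ht, hSt⟩ := exists_facet_of_prod_divisor_ne_zero T (by simp [S]) hS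
  refine mem_moriPoints_of_nonneg_off_facet ht hrel fun v hv => ?_
  have hv0 : v ≠ P.origin := by
    rintro rfl
    refine hv ?_
    rw [origin_val, latt_zero]
    exact T.zero_mem_facets t ht
  have hpv : 0 ≤ p v := by
    by_contra! h
    exact hv (hSt v (Finset.mem_filter.2 ⟨Finset.mem_univ _, hv0, h⟩))
  simp only [Pi.add_apply]
  positivity

theorem gammaFactor_of_nonpos {R : Type*} [CommRing R] (x : R) {k : ℤ} (hk : k ≤ 0) :
    gammaFactor x k = ∏ j ∈ Finset.range (-k).toNat, (x - (j : R)) := by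
  have h : k.toNat = 0 := by omega
  rw [gammaFactor, h, Finset.range_zero, Finset.prod_empty, Ring.inverse_one, mul_one]

theorem prod_erase_gammaFactor (ℓ : P.Point → ℤ) :
    ∏ v ∈ Finset.univ.erase P.origin, gammaFactor (divisor T v) (ℓ v) =
      (∏ v ∈ Finset.univ.erase P.origin, ∏ k ∈ Finset.range (-ℓ v).toNat,
        (divisor T v - (k : CohomologyRing T))) *
      Ring.inverse (∏ v ∈ Finset.univ.erase P.origin,
        ∏ k ∈ Finset.range (ℓ v).toNat, (divisor T v + ((k + 1 : ℕ) : CohomologyRing T))) := by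
  simp only [gammaFactor]
  rw [Finset.prod_mul_distrib]
  congr 1
  exact (map_prod (MonoidWithZero.inverse (M := CohomologyRing T)) _ _).symm

/-- The factors of `O_ℓ` at the origin begin at `D_0 - 1` instead of `D_0`. This form brings `O_ℓ`
itself under the growth bound. -/
theorem coeffO_eq_gammaCoeff {ℓ : P.Point → ℤ} (hℓ : ℓ P.origin ≤ 0) :
    coeffO T ℓ = gammaCoeff (divisor T - Pi.single P.origin 1) ℓ := by
  obtain ⟨D, hD⟩ : ∃ D, D = divisor T - Pi.single P.origin 1 := ⟨_, rfl⟩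
  rw [← hD, coeffO, ← prod_erase_gammaFactor, gammaCoeff,
    ← Finset.mul_prod_erase _ (fun v => gammaFactor (D v) (ℓ v)) (Finset.mem_univ P.origin),
    gammaFactor_of_nonpos _ hℓ, mul_comm, hD]
  congr 1
  · refine Finset.prod_congr rfl fun k _ => ?_
    simp only [Pi.sub_apply, Pi.single_eq_same]
    push_cast
    ring
  · refine Finset.prod_congr rfl fun v hv => ?_
    simp [Finset.ne_of_mem_erase hv]

/-- Multiplying by `D_0` supplies the missing first factor of `D_0(D_0-1)⋯(D_0+ℓ_0)`, which belongs
to the exponent `ℓ_0 - 1`. -/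
theorem coeffO_mul_divisor_origin {ℓ : P.Point → ℤ} (hℓ : ℓ P.origin ≤ 0) :
    coeffO T ℓ * divisor T P.origin = gammaCoeff (divisor T) (ℓ - Pi.single P.origin 1) := by
  obtain ⟨q, hq⟩ : ∃ q, q = ℓ - Pi.single P.origin 1 := ⟨_, rfl⟩
  have hq0 : q P.origin = ℓ P.origin - 1 := by rw [hq]; simp
  rw [← hq, coeffO, ← prod_erase_gammaFactor, gammaCoeff,
    ← Finset.mul_prod_erase _ (fun v => gammaFactor (divisor T v) (q v))
      (Finset.mem_univ P.origin), gammaFactor_of_nonpos _ (by omega), mul_assoc, mul_comm]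
  congr 1
  · have h1 : (-q P.origin).toNat = (-ℓ P.origin).toNat + 1 := by omega
    rw [h1, Finset.prod_range_succ']
    simp
  · refine Finset.prod_congr rfl fun v hv => ?_
    rw [hq]
    simp [Finset.ne_of_mem_erase hv]

theorem isNilpotent_sum_smul_divisor (c : P.Point → ℂ) :
    IsNilpotent (∑ v, c v • divisor T v) := by
  rw [← mem_nilradical]
  refine Ideal.sum_mem _ fun v _ => ?_
  rw [Algebra.smul_def]
  exact Ideal.mul_mem_left _ _ (mem_nilradical.2 (isNilpotent_divisor T v))

theorem map_exp_cohomology {A : Type*} [NormedCommRing A] [NormedAlgebra ℂ A]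
    (φ : CohomologyRing T ≃ₐ[ℂ] A) {x : CohomologyRing T} (hx : IsNilpotent x) :
    φ (IsNilpotent.exp x) = NormedSpace.exp (φ x) := by
  obtain ⟨N, hN⟩ := hx
  rw [IsNilpotent.exp_eq_sum hN, NormedSpace.exp_eq_tsum ℂ, map_sum]
  beta_reduce
  rw [tsum_eq_sum (s := Finset.range N)]
  · refine Finset.sum_congr rfl fun i _ => ?_
    have h : ((i.factorial : ℚ)⁻¹ • x ^ i : CohomologyRing T) =
        (((i.factorial : ℚ)⁻¹ : ℚ) : ℂ) • x ^ i := rfl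
    rw [h, map_smul, map_pow]
    push_cast
    rfl
  · intro i hi
    have hi' : N ≤ i := by simpa using hi
    rw [← map_pow, pow_eq_zero_of_le hi' hN, map_zero, smul_zero]

end Cohomology

/-! ### The gamma series of the cohomology ring -/

section Solution

variable {n : ℕ} {P : ReflexivePolytope n} {T : RegularProjectiveTriangulation P.carrier}

instance (T : RegularProjectiveTriangulation P.carrier) : IsModuleTopology ℂ (CohomologyRing T) :=
  ⟨rfl⟩

theorem expDegree_single (v : P.Point) : expDegree P (Pi.single v 1) = (v.1, 1) := by
  refine Prod.ext ?_ ?_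
  · change ∑ w, (Pi.single v 1 : P.Point → ℤ) w • w.1 = v.1
    rw [Finset.sum_eq_single v]
    · simp
    · intro w _ hw
      simp [hw]
    · simp
  · change ∑ w, (Pi.single v 1 : P.Point → ℤ) w = 1
    simp

theorem expDegree_natCast (m : P.Point → ℕ) :
    expDegree P (fun v => (m v : ℤ)) = ∑ v, m v • expDegree P (Pi.single v 1) := by
  simp only [← map_nsmul]
  rw [← map_sum]
  congr 1
  funext w
  simp [Finset.sum_apply, Pi.single_apply]

/-- The degrees for which the gamma series are supported on a translate of the Mori cone. -/
def negDegrees (P : ReflexivePolytope n) : Set ((Fin n → ℤ) × ℤ) :=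
  {d | ∃ m : P.Point → ℕ, d = -expDegree P fun v => (m v : ℤ)}

/-- The origin gives the degree of the solution itself; a root, being a lattice point of the
polytope, gives the auxiliary series for `£_v`. -/
theorem neg_point_mem_negDegrees (v : P.Point) : (-v.1, -1) ∈ negDegrees P := by
  refine ⟨Pi.single v 1, ?_⟩
  have h : (fun w => ((Pi.single v 1 : P.Point → ℕ) w : ℤ)) = Pi.single v 1 := by
    funext w
    simp [Pi.single_apply]
  rw [h, expDegree_single]
  rfl

theorem sub_mem_negDegrees {d : (Fin n → ℤ) × ℤ} (hd : d ∈ negDegrees P) (v : P.Point) :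
    d - expDegree P (Pi.single v 1) ∈ negDegrees P := by
  obtain ⟨m, rfl⟩ := hd
  refine ⟨m + Pi.single v 1, ?_⟩
  have h : (fun w => ((m + Pi.single v 1 : P.Point → ℕ) w : ℤ)) =
      (fun w => (m w : ℤ)) + Pi.single v 1 := by
    funext w
    simp [Pi.single_apply]
  rw [h, map_add]
  abel

theorem sum_weight_mul_divisor (u : Fin n → ℤ) (k : ℤ) :
    ∑ v : P.Point, ((v.1 ⬝ᵥ u + k : ℤ) : CohomologyRing T) * divisor T v = 0 := by
  have h1 := sum_dotProduct_smul_divisor T (latt u)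
  have h2 : ∀ v : P.Point, ((latt u ⬝ᵥ latt v.1 : ℝ) : ℂ) • divisor T v =
      ((v.1 ⬝ᵥ u : ℤ) : CohomologyRing T) * divisor T v := by
    intro v
    rw [latt_dotProduct, dotProduct_comm u, Complex.ofReal_intCast, Algebra.smul_def, map_intCast]
  simp only [h2] at h1
  simp only [Int.cast_add, add_mul, Finset.sum_add_distrib, h1, ← Finset.mul_sum, sum_divisor,
    mul_zero, add_zero]

theorem sum_weight_mul_exponent (u : Fin n → ℤ) (k : ℤ) (p : P.Point → ℤ) :
    ∑ v : P.Point, (v.1 ⬝ᵥ u + k) * p v = (expDegree P p).1 ⬝ᵥ u + k * (expDegree P p).2 := by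
  change _ = (∑ v, p v • v.1) ⬝ᵥ u + k * ∑ v, p v
  rw [sum_dotProduct, Finset.mul_sum, ← Finset.sum_add_distrib]
  refine Finset.sum_congr rfl fun v _ => ?_
  rw [smul_dotProduct, smul_eq_mul]
  ring

variable {A : Type} [NormedCommRing A] [NormedAlgebra ℂ A] (φ : CohomologyRing T ≃ₐ[ℂ] A)
  {κ : Type} {g : κ → P.Point → ℤ} {C : ℝ}

/-- The images of the divisor classes. -/
def divisorImage (v : P.Point) : A := φ (divisor T v)

theorem map_gammaCoeff_divisor (p : P.Point → ℤ) :
    φ (gammaCoeff (divisor T) p) = gammaCoeff (divisorImage φ) p :=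
  map_gammaCoeff (φ : CohomologyRing T ≃+* A) _ _

theorem isNilpotent_divisorImage (v : P.Point) : IsNilpotent (divisorImage φ v) :=
  (isNilpotent_divisor T v).map φ

theorem exists_isDominated (hgen : ∀ ℓ ∈ moriPoints T, ∃ σ, wordSum g σ = ℓ) :
    ∃ C : ℝ, 1 ≤ C ∧ IsDominated g C (moriPoints T) (fun ℓ => φ (coeffO T ℓ)) ∧
      ∀ d ∈ negDegrees P, IsDominated g C {p | expDegree P p = d} (gammaCoeff (divisorImage φ)) := by
  classical
  obtain ⟨C₁, hC₁, h₁⟩ := norm_gammaCoeff_le (D := divisorImage φ) fun v =>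
    norm_inverse_nilpotent_add_le (isNilpotent_divisorImage φ v)
  obtain ⟨C₂, hC₂, h₂⟩ := norm_gammaCoeff_le
    (D := fun v => φ ((divisor T - Pi.single P.origin 1 : P.Point → CohomologyRing T) v)) fun v => by
      have h := norm_inverse_nilpotent_add_le (isNilpotent_divisorImage φ v)
      by_cases hv : v = P.origin
      · have h3 := norm_inverse_sub_one_add_le h
        have h4 : φ ((divisor T - Pi.single P.origin 1 : P.Point → CohomologyRing T) v) = divisorImage φ v - 1 := by
          subst hv
          simp [divisorImage]
        simpa only [h4] using h3
      · have h4 : φ ((divisor T - Pi.single P.origin 1 : P.Point → CohomologyRing T) v) = divisorImage φ v := by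
          simp [divisorImage, hv]
        simpa only [h4] using h
  refine ⟨max C₁ C₂, hC₁.trans (le_max_left _ _), ?_, ?_⟩
  · obtain ⟨K, hK, h⟩ := h₂ 0
    refine ⟨0, K, hK, fun ℓ hℓ _ => ⟨by simpa using hgen ℓ hℓ, ?_⟩⟩
    have h3 : φ (coeffO T ℓ) =
        gammaCoeff (fun v => φ ((divisor T - Pi.single P.origin 1 : P.Point → CohomologyRing T) v)) ℓ := by
      rw [coeffO_eq_gammaCoeff (moriPoints_origin_nonpos hℓ)]
      exact map_gammaCoeff (φ : CohomologyRing T ≃+* A) _ _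
    change ‖φ (coeffO T ℓ)‖ ≤ _
    rw [h3]
    refine (h ℓ hℓ.1.2).trans ?_
    gcongr
    exact le_max_right _ _
  · rintro d ⟨m, rfl⟩
    obtain ⟨K, hK, h⟩ := h₁ (-expDegree P fun v => (m v : ℤ)).2
    refine ⟨fun v => m v, K, hK, fun p hp hne => ⟨hgen _ ?_, ?_⟩⟩
    · refine add_mem_moriPoints_of_gammaCoeff_ne_zero (fun h0 => hne ?_) ?_
      · rw [← map_gammaCoeff_divisor, h0, map_zero]
      · rw [mem_relations_iff, map_add, hp]
        exact neg_add_cancel _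
    · refine (h p (congrArg Prod.snd hp)).trans ?_
      gcongr
      exact le_max_left _ _

variable [FiniteDimensional ℂ A]

/-- An algebra isomorphism with a normed algebra is a homeomorphism. -/
def cohomologyEquiv : CohomologyRing T ≃L[ℂ] A :=
  haveI : IsModuleTopology ℂ A := isModuleTopologyOfFiniteDimensional
  haveI : ContinuousAdd (CohomologyRing T) := IsModuleTopology.toContinuousAdd ℂ _
  haveI : ContinuousSMul ℂ (CohomologyRing T) := IsModuleTopology.toContinuousSMul ℂ _
  { φ.toLinearEquiv with
    continuous_toFun := IsModuleTopology.continuous_of_linearMap φ.toLinearEquiv.toLinearMap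
    continuous_invFun :=
      IsModuleTopology.continuous_of_linearMap φ.toLinearEquiv.symm.toLinearMap }

variable [Fintype κ] {ε : ℝ}

theorem summable_coeffO (hC : 1 ≤ C) (hε : 0 ≤ ε)
    (hlt : Fintype.card κ * (C ^ genSize g * ε) < 1)
    (hdom : IsDominated g C (moriPoints T) (fun ℓ => φ (coeffO T ℓ))) {a : P.Point → ℂ}
    (ha : a ∈ smallRegion g ε) :
    Summable fun ℓ : moriPoints T => monomial a ℓ.1 • coeffO T ℓ.1 := by
  have : CompleteSpace A := FiniteDimensional.complete ℂ A
  rw [← (cohomologyEquiv φ).summable]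
  refine (hdom.summable hC hε hlt ha).congr fun ℓ => ?_
  exact (map_smul φ (monomial a ℓ.1) (coeffO T ℓ.1)).symm

theorem map_seriesB_mul (lg : (P.Point → ℂ) → (P.Point → ℂ)) {a : P.Point → ℂ}
    (ha : ∀ v, a v ≠ 0)
    (hsum : Summable fun ℓ : moriPoints T => monomial a ℓ.1 • coeffO T ℓ.1) :
    φ (seriesB T lg a * -divisor T P.origin) =
      -gammaSeries (divisorImage φ) lg (expDegree P) (0, -1) a := by
  classical
  have h1 := ((hsum.hasSum.mapL (cohomologyEquiv φ : CohomologyRing T →L[ℂ] A)).mul_right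
    (φ (divisor T P.origin))).const_smul ((a P.origin)⁻¹)
  have hterm : ∀ ℓ : moriPoints T, (a P.origin)⁻¹ •
      ((cohomologyEquiv φ : CohomologyRing T →L[ℂ] A) (monomial a ℓ.1 • coeffO T ℓ.1) *
        φ (divisor T P.origin)) = laurent a (ℓ.1 - Pi.single P.origin 1) •
          gammaCoeff (divisorImage φ) (ℓ.1 - Pi.single P.origin 1) := by
    intro ℓ
    have h2 : (cohomologyEquiv φ : CohomologyRing T →L[ℂ] A) (monomial a ℓ.1 • coeffO T ℓ.1) =
        laurent a ℓ.1 • φ (coeffO T ℓ.1) :=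
      map_smul φ (monomial a ℓ.1) (coeffO T ℓ.1)
    rw [h2, ← map_gammaCoeff_divisor, ← coeffO_mul_divisor_origin (moriPoints_origin_nonpos ℓ.2),
      map_mul, laurent_sub_single ha, smul_mul_assoc, smul_smul, mul_comm (laurent a ℓ.1)]
  simp only [hterm] at h1
  have h2 : ∑' p : {p : P.Point → ℤ | expDegree P p = (0, -1)},
      laurent a p.1 • gammaCoeff (divisorImage φ) p.1 =
      ∑' ℓ : moriPoints T, laurent a (ℓ.1 - Pi.single P.origin 1) •
          gammaCoeff (divisorImage φ) (ℓ.1 - Pi.single P.origin 1) := by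
    let j : moriPoints T → {p : P.Point → ℤ | expDegree P p = (0, -1)} := fun ℓ =>
      ⟨ℓ.1 - Pi.single P.origin 1, by
        have := mem_relations_iff.1 ℓ.2.1
        simp only [Set.mem_ofPred_eq, map_sub, this, expDegree_single, origin_val]
        simp⟩
    have hj : Function.Injective j := by
      intro ℓ ℓ' h
      exact Subtype.ext (sub_left_injective (congrArg Subtype.val h))
    -- The degree fibre is larger than the shifted Mori monoid, but the coefficients outside it
    -- vanish.
    rw [← hj.tsum_eq]
    intro p hp
    have hne : gammaCoeff (divisorImage φ) p.1 ≠ 0 := right_ne_zero_of_smul hp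
    have hcast : (fun v => ((Pi.single P.origin 1 : P.Point → ℕ) v : ℤ)) =
        Pi.single P.origin 1 := by
      funext w
      simp [Pi.single_apply]
    have hmem := add_mem_moriPoints_of_gammaCoeff_ne_zero (T := T) (p := p.1)
      (m := Pi.single P.origin 1)
      (fun h0 => hne (by rw [← map_gammaCoeff_divisor, h0, map_zero])) (by
        have := p.2
        simp only [Set.mem_ofPred_eq] at this
        rw [hcast, mem_relations_iff, map_add, this, expDegree_single, origin_val]
        simp)
    rw [hcast] at hmem
    refine ⟨⟨_, hmem⟩, Subtype.ext ?_⟩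
    simp [j]
  rw [gammaSeries, h2, h1.tsum_eq, seriesB, mul_neg, map_neg, smul_mul_assoc, map_smul, map_mul,
    map_mul, map_exp_cohomology φ (isNilpotent_sum_smul_divisor _), map_sum]
  simp only [map_smul]
  rw [expFactor, smul_mul_assoc]
  congr 2
  rw [mul_right_comm]
  rfl

end Solution

/-! ### Derivatives of families of functions -/

section MixedDerivatives

variable {n : ℕ} {P : ReflexivePolytope n} {U : Set (P.Point → ℂ)} {Λ : Type*} [AddCommGroup Λ]

theorem partialD_eqOn (hU : IsOpen U) {f h : (P.Point → ℂ) → ℂ} (hf : Set.EqOn f h U)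
    (v : P.Point) : Set.EqOn (partialD v f) (partialD v h) U := fun _ ha =>
  (hf.eventuallyEq_of_mem (hU.mem_nhds ha)).lineDeriv_eq

theorem mixedD_eqOn (hU : IsOpen U) {h : Λ → (P.Point → ℂ) → ℂ} {G : Set Λ} {e : P.Point → Λ}
    (hG : ∀ d ∈ G, ∀ v, d - e v ∈ G)
    (hder : ∀ d ∈ G, ∀ v, Set.EqOn (partialD v (h d)) (h (d - e v)) U)
    {f : (P.Point → ℂ) → ℂ} {d : Λ} (hd : d ∈ G) (hf : Set.EqOn f (h d) U) (m : P.Point → ℕ) :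
    Set.EqOn (mixedD m f) (h (d - ∑ v, m v • e v)) U := by
  have hiter : ∀ (v : P.Point) (k : ℕ) (f : (P.Point → ℂ) → ℂ) (d : Λ), d ∈ G →
      Set.EqOn f (h d) U →
      d - k • e v ∈ G ∧ Set.EqOn ((partialD v)^[k] f) (h (d - k • e v)) U := by
    intro v k f d hd hf
    induction k with
    | zero => simpa using ⟨hd, hf⟩
    | succ k ih =>
      have h1 : d - (k + 1) • e v = d - k • e v - e v := by rw [succ_nsmul]; abel
      rw [h1, Function.iterate_succ_apply']
      exact ⟨hG _ ih.1 v, (partialD_eqOn hU ih.2 v).trans (hder _ ih.1 v)⟩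
  have hlist : ∀ l : List P.Point, d - (l.map fun v => m v • e v).sum ∈ G ∧
      Set.EqOn (l.foldr (fun v g => (partialD v)^[m v] g) f)
        (h (d - (l.map fun v => m v • e v).sum)) U := by
    intro l
    induction l with
    | nil => simpa using ⟨hd, hf⟩
    | cons v l ih =>
      have h1 : d - ((v :: l).map fun v => m v • e v).sum =
          d - (l.map fun v => m v • e v).sum - m v • e v := by
        rw [List.map_cons, List.sum_cons]
        abel
      rw [h1, List.foldr_cons]
      exact hiter v (m v) _ _ ih.1 ih.2
  have h2 := (hlist (Finset.univ : Finset P.Point).toList).2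
  rwa [Finset.sum_map_toList] at h2

end MixedDerivatives

end ToricGKZ
end

open ToricGKZ in
theorem mainTheorem2 {n : ℕ} (P : ReflexivePolytope n)
    (T : RegularProjectiveTriangulation P.carrier)
    (T' : RegularProjectiveTriangulation (polarDual P.carrier)) :
    ∃ ε : ℝ, 0 < ε ∧ ε < 1 ∧ IsOpen (nearLCSL T ε) ∧ (nearLCSL T ε).Nonempty ∧
      (∀ a ∈ nearLCSL T ε, Summable fun ℓ : moriPoints T => monomial a ℓ.1 • coeffO T ℓ.1) ∧
      ∀ U : Set (P.Point → ℂ), IsOpen U → U ⊆ nearLCSL T ε →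
        ∀ lg : (P.Point → ℂ) → (P.Point → ℂ), ContinuousOn lg U →
          (∀ a ∈ U, ∀ v, Complex.exp (lg a v) = a v) →
          ∀ α : CohomologyRing T →ₗ[ℂ] ℂ,
            (∀ v u, T'.IsRootWithRay v u → ∀ a ∈ U,
              rootOperator v u (fun b => α (seriesB T lg b * -divisor T P.origin)) a = 0) ∧
            IsExtendedGKZSolution T' U
              (fun b => α (seriesB T lg b * -divisor T P.origin)) := by
  classical
  have := finite_cohomologyRing T
  obtain ⟨A, _, _, _, ⟨φ⟩⟩ := exists_normedCommRing_algEquiv (CohomologyRing T)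
  have : CompleteSpace A := FiniteDimensional.complete ℂ A
  obtain ⟨κ, _, g, hg, hgen, ω₀, hω₀⟩ := exists_mori_generators T
  obtain ⟨C, hC, hdomO, hdom⟩ := exists_isDominated φ hgen
  have hM0 : 0 < Fintype.card κ * C ^ genSize g + 2 := by positivity
  -- The summand `2` keeps `ε < 1` even without generators.
  set ε : ℝ := (Fintype.card κ * C ^ genSize g + 2)⁻¹ with hε_def
  have hε : 0 < ε := inv_pos.2 hM0
  have hε1 : ε < 1 := inv_lt_one_of_one_lt₀ (by
    have : 0 ≤ Fintype.card κ * C ^ genSize g := by positivity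
    linarith)
  have hlt : Fintype.card κ * (C ^ genSize g * ε) < 1 := by
    rw [← mul_assoc, hε_def, mul_inv_lt_iff₀ hM0]
    linarith
  have hregion := nearLCSL_eq_smallRegion hg hgen hε1.le
  have hsum : ∀ a ∈ smallRegion g ε,
      Summable fun ℓ : moriPoints T => monomial a ℓ.1 • coeffO T ℓ.1 := fun a ha =>
    summable_coeffO φ hC hε.le hlt hdomO ha
  refine ⟨ε, hε, hε1, ?_, ?_, ?_, ?_⟩
  all_goals rw [hregion]
  · exact isOpen_smallRegion g ε
  · exact smallRegion_nonempty hω₀ hε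
  · exact hsum
  intro U hU hUg lg hlg hexp α
  -- The sign of `-D_0` is absorbed here.
  let β : A →L[ℂ] ℂ := LinearMap.toContinuousLinearMap (-(α ∘ₗ φ.symm.toLinearMap))
  let F := gammaSeries (divisorImage φ) lg (expDegree P)
  let h : (Fin n → ℤ) × ℤ → (P.Point → ℂ) → ℂ := fun d a => β (F d a)
  have hF : ∀ d ∈ negDegrees P, AnalyticOnNhd ℂ (F d) U := fun d hd =>
    analyticOnNhd_gammaSeries hC hε hlt hU hUg hlg hexp (hdom d hd)
  have hβ : ∀ d ∈ negDegrees P, ∀ a ∈ U, ∀ v,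
      partialD v (h d) a = β (lineDeriv ℂ (F d) a (Pi.single v 1)) := by
    intro d hd a ha v
    have h1 := (hF d hd a ha).differentiableAt.hasFDerivAt
    rw [(h1.hasLineDerivAt _).lineDeriv]
    exact ((β.hasFDerivAt.comp a h1).hasLineDerivAt _).lineDeriv
  have hder : ∀ d ∈ negDegrees P, ∀ v, Set.EqOn (partialD v (h d))
      (h (d - expDegree P (Pi.single v 1))) U := by
    intro d hd v a ha
    rw [hβ d hd a ha v, lineDeriv_gammaSeries hC hε hlt hU hUg hlg hexp
      (isNilpotent_divisorImage φ) (hdom d hd) ha v (hdom _ (sub_mem_negDegrees hd v))]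
  have heuler : ∀ d ∈ negDegrees P, ∀ (u : Fin n → ℤ) (k : ℤ), ∀ a ∈ U,
      ∑ v : P.Point, ((v.1 ⬝ᵥ u + k : ℤ) : ℂ) * a v * partialD v (h d) a =
        ((d.1 ⬝ᵥ u + k * d.2 : ℤ) : ℂ) * h d a := by
    intro d hd u k a ha
    have h1 := sum_mul_lineDeriv_gammaSeries hC hε hlt hU hUg hlg hexp (hdom d hd) ha
      (fun v : P.Point => v.1 ⬝ᵥ u + k) (d.1 ⬝ᵥ u + k * d.2) (by
        have h2 := congrArg φ (sum_weight_mul_divisor (T := T) u k)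
        rw [map_sum, map_zero] at h2
        simpa only [map_mul, map_intCast, divisorImage] using h2)
      (fun p hp => by rw [sum_weight_mul_exponent, hp])
    have h2 := congrArg β h1
    rw [map_sum, map_smul] at h2
    simp only [map_smul, smul_eq_mul] at h2
    simp only [hβ d hd a ha]
    exact h2
  have hd₀ : ((0, -1) : (Fin n → ℤ) × ℤ) ∈ negDegrees P := by
    simpa using neg_point_mem_negDegrees P.origin
  have hf : Set.EqOn (fun b => α (seriesB T lg b * -divisor T P.origin)) (h (0, -1)) U := by
    intro a ha
    have h1 := map_seriesB_mul φ lg (hUg ha).1 (hsum a (hUg ha))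
    have h2 : seriesB T lg a * -divisor T P.origin = -φ.symm (F (0, -1) a) := by
      rw [← map_neg, AlgEquiv.eq_symm_apply]
      exact h1
    change α _ = -(α (φ.symm (F (0, -1) a)))
    rw [h2, map_neg]
  have hfd := partialD_eqOn hU hf
  have hroot : ∀ v u, T'.IsRootWithRay v u → ∀ a ∈ U,
      rootOperator v u (fun b => α (seriesB T lg b * -divisor T P.origin)) a = 0 := by
    intro v u hvu a ha
    have hvP : latt v ∈ P.carrier := by
      simpa using add_mem_of_isRootWithRay hvu P.origin (by simp)
    -- The weight identity is applied to the series of degree `(-v, -1)`, not to the solution; for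
    -- weights `⟨v', u⟩ + 1` its eigenvalue vanishes since `⟨v, u⟩ = -1`.
    have hd₁ : ((-v, -1) : (Fin n → ℤ) × ℤ) ∈ negDegrees P :=
      neg_point_mem_negDegrees (P := P) ⟨v, hvP⟩
    have h1 := heuler _ hd₁ u 1 a ha
    have h2 : ((-v) ⬝ᵥ u + 1 * (-1) : ℤ) = 0 := by
      rw [neg_dotProduct, hvu.2.1]
      norm_num
    simp only [h2, Int.cast_zero, zero_mul] at h1
    rw [← h1, rootOperator]
    refine Finset.sum_congr rfl fun v' _ => ?_
    by_cases hv' : v'.1 ⬝ᵥ u = -1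
    · simp [hv']
    · let w₀ : P.Point := ⟨v'.1 + v, add_mem_of_isRootWithRay hvu v' hv'⟩
      rw [Finset.sum_eq_single w₀]
      -- Both derivatives are the series of degree `(-v - v', -2)`.
      · rw [if_pos ⟨hv', rfl⟩, hfd w₀ ha, hder _ hd₀ w₀ ha, hder _ hd₁ v' ha]
        congr 2
        rw [expDegree_single, expDegree_single]
        refine Prod.ext ?_ rfl
        change 0 - (v'.1 + v) = -v - v'.1
        abel
      · intro w _ hw
        exact if_neg fun h => hw (Subtype.ext h.2)
      · exact fun h => (h (Finset.mem_univ _)).elim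
  refine ⟨hroot, { analytic := ?_, box := ?_, torus := ?_, euler := ?_, root := hroot }⟩
  · have h1 : AnalyticOnNhd ℂ (h (0, -1)) U := fun a ha =>
      (β.analyticAt _).comp (hF _ hd₀ a ha)
    exact h1.congr hU hf.symm
  · intro ℓ hℓ a ha
    have h1 := fun m => mixedD_eqOn hU (fun d hd v => sub_mem_negDegrees hd v) hder hd₀ hf m ha
    rw [h1, h1, ← expDegree_natCast, ← expDegree_natCast]
    -- The positive and negative parts of `ℓ` differ by a relation, which has degree zero.
    have h2 : expDegree P (fun v => ((ℓ v).toNat : ℤ)) =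
        expDegree P (fun v => ((-ℓ v).toNat : ℤ)) := by
      have h3 : (fun v => ((ℓ v).toNat : ℤ)) = ℓ + fun v => ((-ℓ v).toNat : ℤ) := by
        funext v
        simp only [Pi.add_apply]
        omega
      rw [h3, map_add, mem_relations_iff.1 hℓ, zero_add]
    rw [h2, sub_self]
  · intro j a ha
    have h1 := heuler _ hd₀ (Pi.single j 1) 0 a ha
    simp only [dotProduct_single, mul_one, add_zero, zero_mul, Pi.zero_apply, Int.cast_zero] at h1
    rw [← h1]
    exact Finset.sum_congr rfl fun v _ => by rw [hfd v ha]
  · intro a ha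
    have h1 := heuler _ hd₀ 0 1 a ha
    simp only [dotProduct_zero, zero_add, Int.cast_one, one_mul] at h1
    have h2 : ∑ v, a v * partialD v (fun b => α (seriesB T lg b * -divisor T P.origin)) a =
        ∑ v, a v * partialD v (h (0, -1)) a :=
      Finset.sum_congr rfl fun v _ => by rw [hfd v ha]
    have h3 : α (seriesB T lg a * -divisor T P.origin) = h (0, -1) a := hf ha
    rw [h2, h1, h3]
    push_cast
    ring
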